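/- Let $H$ be a complex Hilbert space, let $B(H)_+$ be the set of positive semi-definite bounded linear operators on $H$, and let $1<p\le 2$. Powers of positive semi-definite operators are defined by the functional calculus, and $A\le B$ means that $B-A$ is positive semi-definite. A map $g:(0,\infty)\to B(H)$ is weakly measurable if $x\mapsto\langle \xi, g(x)\eta\rangle$ is Lebesgue measurable for all $\xi,\eta\in H$. For a measurable set $s\subseteq(0,\infty)$, the integral $\int_s g(x)\,dx$ is said to define a bounded linear operator $T$ on $H$ if, for all $\xi,\eta\in H$, the function $x\mapsto\langle\xi,g(x)\eta\rangle$ is integrable over $s$ and $\int_s\langle\xi,g(x)\eta\rangle\,dx=\langle\xi,T\eta\rangle$; then $\int_s g(x)\,dx$ denotes $T$. Let $f:(0,\infty)\to B(H)_+$ be a weakly measurable map such that the integral $\int_0^\infty f(x)^p\,dx$ defines a bounded linear operator on $H$. Then the integrals $\int_0^x f(t)\,dt$ for $x>0$ and $\int_0^\infty\left(\frac1x\int_0^x f(t)\,dt\right)^p dx$ also define bounded linear operators on $H$, and $$\int_0^\infty\left(\frac1x\int_0^x f(t)\,dt\right)^p dx\;\le\;\left(\frac{p}{p-1}\right)^p\int_0^\infty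 f(x)^p\,dx .$$ If $H\ne\{0\}$, the constant $\left(\frac{p}{p-1}\right)^p$ is the best possible: for every real $C<\left(\frac{p}{p-1}\right)^p$ there is a map $f:(0,\infty)\to B(H)_+$ as above for which the inequality with $C$ in place of $\left(\frac{p}{p-1}\right)^p$ fails. -/

import Mathlib

open MeasureTheory Set

/-- An operator-valued map on `(0, ∞)` is weakly measurable if all its matrix coefficients
`x ↦ ⟪ξ, f x η⟫` are Lebesgue measurable on `(0, ∞)`. Values of `f` outside `(0, ∞)` are
irrelevant. -/
def WeaklyMeasurable {H : Type*} [NormedAddCommGroup H] [InnerProductSpace ℂ H]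
    (f : ℝ → H →L[ℂ] H) : Prop :=
  ∀ ξ η : H, AEStronglyMeasurable (fun x => inner ℂ ξ (f x η)) (volume.restrict (Ioi 0))

/-- The bounded operator `T` is the weak integral `∫_s g(x) dx`:
for all vectors `ξ, η` the function `x ↦ ⟪ξ, g x η⟫` is integrable over `s`,
with integral `⟪ξ, T η⟫`. -/
def HasWeakIntegral {H : Type*} [NormedAddCommGroup H] [InnerProductSpace ℂ H]
    (g : ℝ → H →L[ℂ] H) (s : Set ℝ) (T : H →L[ℂ] H) : Prop :=
  ∀ ξ η : H, IntegrableOn (fun x => inner ℂ ξ (g x η)) s ∧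
    ∫ x in s, inner ℂ ξ (g x η) = inner ℂ ξ (T η)

/-- The integral `∫_s g(x) dx` defines a bounded linear operator on `H`. -/
def WeaklyIntegrableOn {H : Type*} [NormedAddCommGroup H] [InnerProductSpace ℂ H]
    (g : ℝ → H →L[ℂ] H) (s : Set ℝ) : Prop :=
  ∃ T : H →L[ℂ] H, HasWeakIntegral g s T

theorem HasWeakIntegral.unique {H : Type*} [NormedAddCommGroup H] [InnerProductSpace ℂ H]
    {g : ℝ → H →L[ℂ] H} {s : Set ℝ} {T S : H →L[ℂ] H}
    (hT : HasWeakIntegral g s T) (hS : HasWeakIntegral g s S) : T = S := by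
  ext η
  exact ext_inner_left ℂ fun ξ => (hT ξ η).2.symm.trans (hS ξ η).2

open Classical in
/-- The bounded operator `∫_s g(x) dx` (weak integral), with the default value `0` if this
integral does not define a bounded operator. -/
noncomputable def weakIntegral {H : Type*} [NormedAddCommGroup H] [InnerProductSpace ℂ H]
    (g : ℝ → H →L[ℂ] H) (s : Set ℝ) : H →L[ℂ] H :=
  if h : WeaklyIntegrableOn g s then h.choose else 0

theorem HasWeakIntegral.weakIntegral_eq {H : Type*} [NormedAddCommGroup H]
    [InnerProductSpace ℂ H] {g : ℝ → H →L[ℂ] H} {s : Set ℝ} {T : H →L[ℂ] H}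
    (hT : HasWeakIntegral g s T) : weakIntegral g s = T := by
  have h : WeaklyIntegrableOn g s := ⟨T, hT⟩
  rw [weakIntegral, dif_pos h]
  exact h.choose_spec.unique hT

/-- The average `(1/x) ∫₀ˣ f(t) dt`. -/
noncomputable def hardyAverage {H : Type*} [NormedAddCommGroup H] [InnerProductSpace ℂ H]
    (f : ℝ → H →L[ℂ] H) (x : ℝ) : H →L[ℂ] H :=
  (1 / x) • weakIntegral f (Ioc 0 x)

/-!
Hardy's inequality for positive operators follows from an operator Jensen inequality with a weight
adapted to the exponent, followed by Tonelli's theorem for quadratic forms.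

Let `c = 1 - 1 / p`. On `(0, x]` the function `c x ^ (-c) t ^ (c - 1)` is a probability density, and
Jensen's inequality for `a ↦ a ^ p` with this weight (`re_inner_hardyAverage_rpow_le`) bounds the
form of `(x⁻¹ ∫₀ˣ f) ^ p` at a vector `ξ` by `c ^ (1 - p) x ^ (-1 - c) ∫₀ˣ t ^ c ⟪ξ, f t ^ p ξ⟫ dt`.
Integration over `x` (`integral_rpow_mul_integral_Ioc`) turns this into `c ^ (-p) ∫ ⟪ξ, f ^ p ξ⟫`,
and `c ^ (-p)` is the constant `(p / (p - 1)) ^ p`.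

Since `f` is only weakly measurable and `H` need not be separable, Jensen's inequality
(`re_inner_rpow_le_integral`) is proved without approximating `f` in norm. For `1 < p < 2` the power
`a ^ p` is an integral over `l > 0` of positive multiples of `a² (l + a)⁻¹`. The quadratic form of
the latter at `ξ` is the maximum over vectors `η` of `2 re ⟪η, a ξ⟫ - ⟪η, a η⟫ - l ‖η‖²`, an
expression affine in `a` (`resolventForm_le`, `resolventForm_mulResolvent`). Inserting the maximiser
belonging to the average gives affine lower bounds that involve only matrix coefficients of `f`,
and Fubini's theorem for the pair `(l, t)` concludes. For `p = 2` the tangent of `‖a ξ‖²` suffices.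

A positive family whose quadratic forms have bounded integrals has a bounded weak integral
(`exists_operator_of_quadratic`). This gives the primitive of `f`, by means of the operator
inequality `a ≤ δ + δ ^ (1 - p) a ^ p`, and the left-hand side of Hardy's inequality, once the
Hardy averages are known to be measurable: they are norm continuous
(`continuousOn_weakIntegral_Ioc`).

The constant is optimal because of the scalar functions `x ^ (-a)` on `(0, 1]`, whose averages there
are `(1 - a)⁻¹ x ^ (-a)`, as `a` increases to `1 / p`.
-/

/-! ### Positive operators and weak integrals of positive families -/

section

variable {H : Type*} [NormedAddCommGroup H] [InnerProductSpace ℂ H]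

theorem re_inner_nonneg_of_nonneg {T : H →L[ℂ] H} (hT : 0 ≤ T) (ξ : H) :
    0 ≤ (inner ℂ ξ (T ξ)).re :=
  ((ContinuousLinearMap.nonneg_iff_isPositive T).1 hT).re_inner_nonneg_right ξ

theorem ofReal_re_inner_of_nonneg {T : H →L[ℂ] H} (hT : 0 ≤ T) (ξ : H) :
    (((inner ℂ ξ (T ξ)).re : ℝ) : ℂ) = inner ℂ ξ (T ξ) := by
  have h := ((ContinuousLinearMap.nonneg_iff_isPositive T).1 hT).inner_nonneg_right ξ
  exact (Complex.eq_re_of_ofReal_le h).symm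

theorem integral_re_inner {α : Type*} [MeasurableSpace α] {μ : Measure α} {g : α → H →L[ℂ] H}
    {T : H →L[ℂ] H} {ξ η : H}
    (h : Integrable (fun t => inner ℂ ξ (g t η)) μ ∧
      ∫ t, inner ℂ ξ (g t η) ∂μ = inner ℂ ξ (T η)) :
    ∫ t, (inner ℂ ξ (g t η)).re ∂μ = (inner ℂ ξ (T η)).re := by
  rw [← h.2]
  exact integral_re h.1

theorem nonneg_of_integral_inner {α : Type*} [MeasurableSpace α] {μ : Measure α}
    {g : α → H →L[ℂ] H} (hg : ∀ᵐ t ∂μ, 0 ≤ g t) {T : H →L[ℂ] H}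
    (hT : ∀ ξ η : H, Integrable (fun t => inner ℂ ξ (g t η)) μ ∧
      ∫ t, inner ℂ ξ (g t η) ∂μ = inner ℂ ξ (T η)) : 0 ≤ T := by
  rw [ContinuousLinearMap.nonneg_iff_isPositive, ContinuousLinearMap.isPositive_iff_complex]
  intro ξ
  have h1 : ((∫ t, (inner ℂ ξ (g t ξ)).re ∂μ : ℝ) : ℂ) = inner ℂ ξ (T ξ) := by
    rw [← (hT ξ ξ).2]
    refine (integral_ofReal (𝕜 := ℂ)).symm.trans ?_
    exact integral_congr_ae (hg.mono fun t ht => ofReal_re_inner_of_nonneg ht ξ)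
  have h2 : 0 ≤ ∫ t, (inner ℂ ξ (g t ξ)).re ∂μ :=
    integral_nonneg_of_ae (hg.mono fun t ht => re_inner_nonneg_of_nonneg ht ξ)
  have h3 : inner ℂ (T ξ) ξ = ((∫ t, (inner ℂ ξ (g t ξ)).re ∂μ : ℝ) : ℂ) := by
    rw [← inner_conj_symm, ← h1, Complex.conj_ofReal]
  rw [h3]
  exact ⟨by simp, by simpa using h2⟩

variable [CompleteSpace H]

theorem le_iff_re_inner_le {S T : H →L[ℂ] H} (hS : 0 ≤ S) (hT : 0 ≤ T) :
    S ≤ T ↔ ∀ ξ, (inner ℂ ξ (S ξ)).re ≤ (inner ℂ ξ (T ξ)).re := by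
  constructor
  · intro h ξ
    have := re_inner_nonneg_of_nonneg (sub_nonneg.2 h) ξ
    simpa [inner_sub_right] using this
  · intro h
    rw [ContinuousLinearMap.le_def]
    have hS' := (ContinuousLinearMap.nonneg_iff_isPositive S).1 hS
    have hT' := (ContinuousLinearMap.nonneg_iff_isPositive T).1 hT
    refine ⟨?_, fun ξ => ?_⟩
    · exact hT'.isSymmetric.sub hS'.isSymmetric
    · have := h ξ
      rw [ContinuousLinearMap.reApplyInnerSelf_apply, inner_re_symm]
      simpa [inner_sub_right] using this

/-- The Cauchy-Schwarz inequality for the form of a positive operator, with the geometric mean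
replaced by a weighted arithmetic mean so that it can be integrated. -/
theorem norm_inner_le_of_nonneg {T : H →L[ℂ] H} (hT : 0 ≤ T) (ξ η : H) {s : ℝ} (hs : 0 < s) :
    ‖inner ℂ ξ (T η)‖ ≤
      (s * (inner ℂ ξ (T ξ)).re + s⁻¹ * (inner ℂ η (T η)).re) / 2 := by
  obtain ⟨S, rfl⟩ := CStarAlgebra.nonneg_iff_eq_star_mul_self.1 hT
  have key : ∀ x y : H, inner ℂ x ((star S * S) y) = inner ℂ (S x) (S y) := fun x y => by
    rw [ContinuousLinearMap.star_eq_adjoint, mul_apply_eq_comp,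
      ContinuousLinearMap.adjoint_inner_right]
  have key2 : ∀ x : H, (inner ℂ x ((star S * S) x)).re = ‖S x‖ ^ 2 := fun x => by
    rw [key, inner_self_eq_norm_sq_to_K]
    norm_cast
  rw [key2, key2, key]
  refine (norm_inner_le_norm _ _).trans ?_
  have h : s⁻¹ * (s * ‖S ξ‖ - ‖S η‖) ^ 2 =
      s * ‖S ξ‖ ^ 2 + s⁻¹ * ‖S η‖ ^ 2 - 2 * (‖S ξ‖ * ‖S η‖) := by
    field_simp
    ring
  have h2 : 0 ≤ s⁻¹ * (s * ‖S ξ‖ - ‖S η‖) ^ 2 := by positivity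
  linarith

section WeakIntegral

variable {α : Type*} [MeasurableSpace α] {μ : Measure α} {g : α → H →L[ℂ] H}

/-- A positive family whose quadratic forms have bounded integrals has integrable matrix
coefficients, with the matching bound: optimise the weight in `norm_inner_le_of_nonneg`. -/
theorem integrable_inner_of_quadratic (hg : ∀ᵐ t ∂μ, 0 ≤ g t)
    (hm : ∀ ξ η : H, AEStronglyMeasurable (fun t => inner ℂ ξ (g t η)) μ) {C : ℝ}
    (hi : ∀ ξ : H, Integrable (fun t => (inner ℂ ξ (g t ξ)).re) μ)
    (hC : ∀ ξ : H, ∫ t, (inner ℂ ξ (g t ξ)).re ∂μ ≤ C * ‖ξ‖ ^ 2) (ξ η : H) :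
    Integrable (fun t => inner ℂ ξ (g t η)) μ ∧
      ∫ t, ‖(inner ℂ ξ (g t η) : ℂ)‖ ∂μ ≤ C * (‖ξ‖ * ‖η‖) := by
  have hb : ∀ s : ℝ, 0 < s → ∀ᵐ t ∂μ, ‖(inner ℂ ξ (g t η) : ℂ)‖ ≤
      (s * (inner ℂ ξ (g t ξ)).re + s⁻¹ * (inner ℂ η (g t η)).re) / 2 := fun s hs => by
    filter_upwards [hg] with t ht using norm_inner_le_of_nonneg ht ξ η hs
  have hbi : ∀ s : ℝ, Integrable (fun t =>
      (s * (inner ℂ ξ (g t ξ)).re + s⁻¹ * (inner ℂ η (g t η)).re) / 2) μ := fun s =>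
    (((hi ξ).const_mul s).add ((hi η).const_mul s⁻¹)).div_const 2
  have hint : Integrable (fun t => inner ℂ ξ (g t η)) μ :=
    (hbi 1).mono' (hm ξ η) (hb 1 one_pos)
  refine ⟨hint, ?_⟩
  rcases eq_or_ne ξ 0 with rfl | hξ
  · simp
  rcases eq_or_ne η 0 with rfl | hη
  · simp
  have hξ' : 0 < ‖ξ‖ := norm_pos_iff.2 hξ
  have hη' : 0 < ‖η‖ := norm_pos_iff.2 hη
  have hs : 0 < ‖η‖ / ‖ξ‖ := by positivity
  calc ∫ t, ‖(inner ℂ ξ (g t η) : ℂ)‖ ∂μ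
      ≤ ∫ t, (‖η‖ / ‖ξ‖ * (inner ℂ ξ (g t ξ)).re +
          (‖η‖ / ‖ξ‖)⁻¹ * (inner ℂ η (g t η)).re) / 2 ∂μ :=
        integral_mono_ae hint.norm (hbi _) (hb _ hs)
    _ = (‖η‖ / ‖ξ‖ * ∫ t, (inner ℂ ξ (g t ξ)).re ∂μ +
          (‖η‖ / ‖ξ‖)⁻¹ * ∫ t, (inner ℂ η (g t η)).re ∂μ) / 2 := by
        rw [integral_div, integral_add ((hi ξ).const_mul _) ((hi η).const_mul _),
          integral_const_mul, integral_const_mul]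
    _ ≤ (‖η‖ / ‖ξ‖ * (C * ‖ξ‖ ^ 2) + (‖η‖ / ‖ξ‖)⁻¹ * (C * ‖η‖ ^ 2)) / 2 := by
        gcongr <;> exact hC _
    _ = C * (‖ξ‖ * ‖η‖) := by
        field_simp
        ring

/-- By `integrable_inner_of_quadratic` the sesquilinear form `(ξ, η) ↦ ∫ ⟪ξ, g η⟫` is bounded, so it
is represented by an operator. -/
theorem exists_operator_of_quadratic (hg : ∀ᵐ t ∂μ, 0 ≤ g t)
    (hm : ∀ ξ η : H, AEStronglyMeasurable (fun t => inner ℂ ξ (g t η)) μ) {C : ℝ}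
    (hi : ∀ ξ : H, Integrable (fun t => (inner ℂ ξ (g t ξ)).re) μ)
    (hC : ∀ ξ : H, ∫ t, (inner ℂ ξ (g t ξ)).re ∂μ ≤ C * ‖ξ‖ ^ 2) :
    ∃ T : H →L[ℂ] H, ∀ ξ η : H, Integrable (fun t => inner ℂ ξ (g t η)) μ ∧
      ∫ t, inner ℂ ξ (g t η) ∂μ = inner ℂ ξ (T η) := by
  have key := integrable_inner_of_quadratic hg hm hi hC
  let B : H →ₗ⋆[ℂ] H →ₗ[ℂ] ℂ := LinearMap.mk₂'ₛₗ (starRingEnd ℂ) (RingHom.id ℂ)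
    (fun ξ η => ∫ t, inner ℂ ξ (g t η) ∂μ)
    (fun x y z => by
      simp only [inner_add_left]
      exact integral_add (key x z).1 (key y z).1)
    (fun c x y => by simp only [inner_smul_left, integral_const_mul, smul_eq_mul])
    (fun x y z => by
      simp only [map_add, inner_add_right]
      exact integral_add (key x y).1 (key x z).1)
    (fun c x y => by simp [integral_const_mul])
  let B' : H →L⋆[ℂ] H →L[ℂ] ℂ := B.mkContinuous₂ C fun ξ η => by
    rw [mul_assoc]
    exact (norm_integral_le_integral_norm _).trans (key ξ η).2
  refine ⟨ContinuousLinearMap.adjoint (InnerProductSpace.continuousLinearMapOfBilin B'),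
    fun ξ η => ⟨(key ξ η).1, ?_⟩⟩
  rw [ContinuousLinearMap.adjoint_inner_right,
    InnerProductSpace.continuousLinearMapOfBilin_apply]
  rfl

end WeakIntegral

end

/-! ### Powers of positive operators and resolvents -/

section

variable {H : Type*} [NormedAddCommGroup H] [InnerProductSpace ℂ H] [CompleteSpace H]

theorem spectrum_nonneg_real {a : H →L[ℂ] H} (ha : 0 ≤ a) {x : ℝ} (hx : x ∈ spectrum ℝ a) :
    0 ≤ x := spectrum_nonneg_of_nonneg ha hx

theorem rpow_smul_of_nonneg {a : H →L[ℂ] H} (ha : 0 ≤ a) {r p : ℝ} (hr : 0 ≤ r) (hp : 0 ≤ p) :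
    (r • a) ^ p = r ^ p • a ^ p := by
  have hra : 0 ≤ r • a := smul_nonneg hr ha
  have hc : Continuous fun x : ℝ => x ^ p := Real.continuous_rpow_const hp
  rw [CFC.rpow_eq_cfc_real hra, CFC.rpow_eq_cfc_real ha,
    ← cfc_comp_smul r (fun x : ℝ => x ^ p) a hc.continuousOn,
    ← cfc_smul (r ^ p) (fun x : ℝ => x ^ p) a hc.continuousOn]
  refine cfc_congr fun x hx => ?_
  simp [Real.mul_rpow hr (spectrum_nonneg_real ha hx)]

/-- The scalar inequality `t ≤ δ + δ ^ (1 - p) * t ^ p`, transferred to operators. -/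
theorem le_smul_one_add_rpow {a : H →L[ℂ] H} (ha : 0 ≤ a) {p δ : ℝ} (hp : 1 ≤ p) (hδ : 0 < δ) :
    a ≤ δ • (1 : H →L[ℂ] H) + δ ^ (1 - p) • a ^ p := by
  have hc : Continuous fun x : ℝ => x ^ p := Real.continuous_rpow_const (by linarith)
  have h1 : δ • (1 : H →L[ℂ] H) + δ ^ (1 - p) • a ^ p =
      cfc (fun x : ℝ => δ + δ ^ (1 - p) * x ^ p) a := by
    rw [cfc_add a (fun _ => δ) (fun x => δ ^ (1 - p) * x ^ p)
        continuousOn_const (by fun_prop), cfc_const δ a,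
      cfc_const_mul _ (fun x : ℝ => x ^ p) a hc.continuousOn, ← CFC.rpow_eq_cfc_real ha,
      Algebra.algebraMap_eq_smul_one]
  rw [h1]
  conv_lhs => rw [← cfc_id ℝ a]
  refine cfc_mono (fun x hx => ?_) (by fun_prop) (by fun_prop)
  have hx0 := spectrum_nonneg_real ha hx
  rcases le_total x δ with h | h
  · have : 0 ≤ δ ^ (1 - p) * x ^ p := by positivity
    simp only [id_eq]
    linarith
  · have hx1 : 0 < x := hδ.trans_le h
    have h2 : x ^ (1 - p) ≤ δ ^ (1 - p) := Real.rpow_le_rpow_of_nonpos hδ h (by linarith)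
    have h3 : x = x ^ (1 - p) * x ^ p := by
      rw [← Real.rpow_add hx1]
      simp
    have h4 : x ^ (1 - p) * x ^ p ≤ δ ^ (1 - p) * x ^ p := by gcongr
    simp only [id_eq]
    linarith

/-- The operator `a (l + a)⁻¹`, defined by functional calculus. -/
noncomputable def mulResolvent (a : H →L[ℂ] H) (l : ℝ) : H →L[ℂ] H :=
  cfc (fun x : ℝ => x / (l + x)) a

theorem continuousOn_div_add_spectrum {a : H →L[ℂ] H} (ha : 0 ≤ a) {l : ℝ} (hl : 0 < l) :
    ContinuousOn (fun x : ℝ => x / (l + x)) (spectrum ℝ a) :=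
  continuousOn_id.div (by fun_prop) fun x hx => by
    have := spectrum_nonneg_real ha hx
    positivity

theorem mul_mulResolvent_add_smul {a : H →L[ℂ] H} (ha : 0 ≤ a) {l : ℝ} (hl : 0 < l) :
    a * mulResolvent a l + l • mulResolvent a l = a := by
  have hc := continuousOn_div_add_spectrum ha hl
  have h1 : a * mulResolvent a l = cfc (fun x : ℝ => x * (x / (l + x))) a := by
    rw [cfc_mul (fun x => x) _ a continuousOn_id hc, cfc_id' ℝ a, mulResolvent]
  rw [h1, mulResolvent, ← cfc_const_mul l _ a hc,
    ← cfc_add a (fun x => x * (x / (l + x))) (fun x => l * (x / (l + x)))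
      (continuousOn_id.mul hc) (continuousOn_const.mul hc)]
  conv_rhs => rw [← cfc_id' ℝ a]
  refine cfc_congr fun x hx => ?_
  have := spectrum_nonneg_real ha hx
  have : l + x ≠ 0 := by positivity
  field_simp
  ring

theorem cfc_rpowIntegrand_eq {a : H →L[ℂ] H} (ha : 0 ≤ a) {p l : ℝ} (hl : 0 < l) :
    cfc (Real.rpowIntegrand₁₂ p l) a = l ^ (p - 2) • (a * mulResolvent a l) := by
  have hc := continuousOn_div_add_spectrum ha hl
  have h1 : a * mulResolvent a l = cfc (fun x : ℝ => x * (x / (l + x))) a := by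
    rw [cfc_mul (fun x => x) _ a continuousOn_id hc, cfc_id' ℝ a, mulResolvent]
  rw [h1, ← cfc_const_mul _ (fun x => x * (x / (l + x))) a (continuousOn_id.mul hc)]
  refine cfc_congr fun x hx => ?_
  have := spectrum_nonneg_real ha hx
  have : l + x ≠ 0 := by positivity
  have h2 : l ^ (p - 1) = l ^ (p - 2) * l := by
    rw [← Real.rpow_add_one hl.ne']
    ring_nf
  simp only [Real.rpowIntegrand₁₂]
  rw [h2]
  field_simp
  ring

/-- The concave functional of `η` whose maximum, attained at `mulResolvent a l ξ`, is
`⟪ξ, a² (l + a)⁻¹ ξ⟫`. It is affine in the operator `a`. -/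
noncomputable def resolventForm (a : H →L[ℂ] H) (l : ℝ) (ξ η : H) : ℝ :=
  2 * (inner ℂ η (a ξ)).re - (inner ℂ η (a η)).re - l * ‖η‖ ^ 2

/-- Completing the square. -/
theorem re_inner_mul_mulResolvent_sub {a : H →L[ℂ] H} (ha : 0 ≤ a) {l : ℝ} (hl : 0 < l)
    (ξ η : H) :
    (inner ℂ ξ ((a * mulResolvent a l) ξ)).re - resolventForm a l ξ η =
      (inner ℂ (η - mulResolvent a l ξ) (a (η - mulResolvent a l ξ))).re +
        l * ‖η - mulResolvent a l ξ‖ ^ 2 := by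
  set ρ := mulResolvent a l ξ with hρ
  have hr : a ξ = a ρ + (l : ℂ) • ρ := by
    conv_lhs => rw [← mul_mulResolvent_add_smul ha hl]
    simp [hρ]
  have hsa : ∀ x y : H, (inner ℂ x (a y)).re = (inner ℂ y (a x)).re := fun x y => by
    rw [← ((ContinuousLinearMap.nonneg_iff_isPositive a).1 ha).inner_left_eq_inner_right x y]
    exact inner_re_symm (𝕜 := ℂ) _ _
  have hn : ∀ x : H, ‖x‖ ^ 2 = (inner ℂ x x).re := fun x => by
    rw [inner_self_eq_norm_sq_to_K]
    norm_cast
  have h1 : (inner ℂ ξ ((a * mulResolvent a l) ξ)).re =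
      (inner ℂ ρ (a ρ)).re + l * (inner ℂ ρ ρ).re := by
    rw [mul_apply_eq_comp, ← hρ, hsa, hr]
    simp
  have h2 : (inner ℂ ρ η).re = (inner ℂ η ρ).re := inner_re_symm (𝕜 := ℂ) _ _
  rw [h1, resolventForm, hr, hn, hn]
  simp only [map_sub, inner_sub_left, inner_sub_right, inner_add_right, inner_smul_right,
    Complex.sub_re, Complex.add_re, Complex.re_ofReal_mul, hsa ρ η, h2]
  ring

theorem resolventForm_le {a : H →L[ℂ] H} (ha : 0 ≤ a) {l : ℝ} (hl : 0 < l) (ξ η : H) :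
    resolventForm a l ξ η ≤ (inner ℂ ξ ((a * mulResolvent a l) ξ)).re := by
  have h := re_inner_mul_mulResolvent_sub ha hl ξ η
  have h1 := re_inner_nonneg_of_nonneg ha (η - mulResolvent a l ξ)
  have h2 : 0 ≤ l * ‖η - mulResolvent a l ξ‖ ^ 2 := by positivity
  linarith

theorem resolventForm_mulResolvent {a : H →L[ℂ] H} (ha : 0 ≤ a) {l : ℝ} (hl : 0 < l) (ξ : H) :
    resolventForm a l ξ (mulResolvent a l ξ) =
      (inner ℂ ξ ((a * mulResolvent a l) ξ)).re := by
  have h := re_inner_mul_mulResolvent_sub ha hl ξ (mulResolvent a l ξ)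
  simp only [sub_self, map_zero, inner_zero_right, Complex.zero_re, norm_zero] at h
  linarith

theorem spectrum_le_norm {a : H →L[ℂ] H} {x : ℝ} (hx : x ∈ spectrum ℝ a) : x ≤ ‖a‖ := by
  have h := spectrum.norm_le_norm_mul_of_mem hx
  have h1 : ‖(1 : H →L[ℂ] H)‖ ≤ 1 := ContinuousLinearMap.norm_id_le
  calc x ≤ ‖x‖ := Real.le_norm_self x
    _ ≤ ‖a‖ * ‖(1 : H →L[ℂ] H)‖ := h
    _ ≤ ‖a‖ := mul_le_of_le_one_right (norm_nonneg _) h1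

theorem norm_mulResolvent_le {a : H →L[ℂ] H} (ha : 0 ≤ a) {l : ℝ} (hl : 0 < l) :
    ‖mulResolvent a l‖ ≤ (1 + ‖a‖) / (l + 1) := by
  refine norm_cfc_le (by positivity) fun x hx => ?_
  have h0 := spectrum_nonneg_real ha hx
  have h1 := spectrum_le_norm hx
  rw [Real.norm_of_nonneg (by positivity), div_le_div_iff₀ (by positivity) (by positivity)]
  nlinarith [mul_nonneg hl.le (sub_nonneg.2 h1), mul_nonneg h0 (norm_nonneg a)]

theorem continuousOn_mulResolvent {a : H →L[ℂ] H} (ha : 0 ≤ a) :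
    ContinuousOn (mulResolvent a) (Ioi 0) := by
  have hlip : ∀ l ∈ Ioi (0 : ℝ), ∀ m ∈ Ioi (0 : ℝ),
      ‖mulResolvent a m - mulResolvent a l‖ ≤ |m - l| / l := by
    intro l (hl : 0 < l) m (hm : 0 < m)
    rw [mulResolvent, mulResolvent, ← cfc_sub _ _ a (continuousOn_div_add_spectrum ha hm)
      (continuousOn_div_add_spectrum ha hl)]
    refine norm_cfc_le (by positivity) fun x hx => ?_
    have h0 := spectrum_nonneg_real ha hx
    have h1 : x / (m + x) - x / (l + x) = x / (m + x) * ((l - m) / (l + x)) := by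
      field_simp
      ring
    have h2 : x / (m + x) ≤ 1 := (div_le_one (by positivity)).2 (by linarith)
    rw [h1, norm_mul, Real.norm_of_nonneg (by positivity : 0 ≤ x / (m + x)), norm_div,
      Real.norm_of_nonneg (by positivity : 0 ≤ l + x), Real.norm_eq_abs, abs_sub_comm]
    calc x / (m + x) * (|m - l| / (l + x)) ≤ 1 * (|m - l| / l) := by
          gcongr
          linarith
      _ = |m - l| / l := one_mul _
  intro l hl
  rw [ContinuousWithinAt, tendsto_iff_norm_sub_tendsto_zero]
  have ht : Filter.Tendsto (fun m : ℝ => |m - l| / l) (nhdsWithin l (Ioi 0)) (nhds 0) := by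
    have : Continuous fun m : ℝ => |m - l| / l := by fun_prop
    have h := this.tendsto l
    simp only [sub_self, abs_zero, zero_div] at h
    exact h.mono_left nhdsWithin_le_nhds
  refine squeeze_zero' (Filter.Eventually.of_forall fun _ => norm_nonneg _) ?_ ht
  filter_upwards [self_mem_nhdsWithin] with m hm using hlip l hl m hm

/-- The constant that normalises the integral representation of `x ↦ x ^ p`, `1 < p < 2`. -/
noncomputable def rpowConst (p : ℝ) : ℝ := (∫ t in Ioi 0, Real.rpowIntegrand₀₁ (p - 1) t 1)⁻¹

theorem rpowConst_nonneg {p : ℝ} (hp : p ∈ Ioo (1 : ℝ) 2) : 0 ≤ rpowConst p :=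
  inv_nonneg.2 (Real.integral_rpowIntegrand₀₁_one_pos ⟨by linarith [hp.1], by linarith [hp.2]⟩).le

/-- The integral representation of `a ^ p` for `1 < p < 2`, with Lebesgue measure. -/
theorem integrableOn_cfc_rpowIntegrand {p : ℝ} (hp : p ∈ Ioo (1 : ℝ) 2) {a : H →L[ℂ] H}
    (ha : 0 ≤ a) :
    IntegrableOn (fun l => cfc (Real.rpowIntegrand₁₂ p l) a) (Ioi 0) ∧
      a ^ p = rpowConst p • ∫ l in Ioi 0, cfc (Real.rpowIntegrand₁₂ p l) a := by
  have hcont : ContinuousOn (Function.uncurry (Real.rpowIntegrand₁₂ p))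
      (Ioi (0 : ℝ) ×ˢ spectrum ℝ a) :=
    Real.continuousOn_rpowIntegrand₁₂_uncurry hp.1 _ fun x hx => spectrum_nonneg_real ha hx
  have hbound : ∀ᵐ l ∂volume.restrict (Ioi (0 : ℝ)), ∀ x ∈ spectrum ℝ a,
      ‖Real.rpowIntegrand₁₂ p l x‖ ≤ Real.rpowIntegrand₁₂ p l ‖a‖ := by
    filter_upwards [ae_restrict_mem measurableSet_Ioi] with l hl x hx
    have hx0 := spectrum_nonneg_real ha hx
    rw [Real.norm_of_nonneg (Real.rpowIntegrand₁₂_nonneg hp.1 (le_of_lt hl) hx0)]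
    exact Real.monotoneOn_rpowIntegrand₁₂ hp hl hx0 (norm_nonneg a) (spectrum_le_norm hx)
  have hfin : HasFiniteIntegral (fun l => Real.rpowIntegrand₁₂ p l ‖a‖)
      (volume.restrict (Ioi (0 : ℝ))) :=
    (Real.integrableOn_rpowIntegrand₁₂ hp (norm_nonneg a)).2
  refine ⟨integrableOn_cfc measurableSet_Ioi _ _ a hcont hbound hfin, ?_⟩
  have hsm := cfc_setIntegral measurableSet_Ioi _ _ a hcont hbound hfin
  have hcint : ContinuousOn (fun r => ∫ l in Ioi 0, Real.rpowIntegrand₁₂ p l r)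
      (spectrum ℝ a) := by
    have hc : Continuous fun x : ℝ => (rpowConst p)⁻¹ * x ^ p :=
      continuous_const.mul (Real.continuous_rpow_const (by linarith [hp.1]))
    refine hc.continuousOn.congr fun x hx => ?_
    have h := Real.rpow_eq_const_mul_integral_rpowIntegrand₁₂ hp (spectrum_nonneg_real ha hx)
    have hK : 0 < ∫ t in Ioi 0, Real.rpowIntegrand₀₁ (p - 1) t 1 :=
      Real.integral_rpowIntegrand₀₁_one_pos ⟨by linarith [hp.1], by linarith [hp.2]⟩
    simp only [rpowConst, inv_inv, h]
    field_simp
  rw [← hsm, CFC.rpow_eq_cfc_real ha, ← cfc_smul (rpowConst p) _ a hcint]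
  exact cfc_congr fun x hx =>
    Real.rpow_eq_const_mul_integral_rpowIntegrand₁₂ hp (spectrum_nonneg_real ha hx)

theorem re_inner_rpow_eq_integral {p : ℝ} (hp : p ∈ Ioo (1 : ℝ) 2) {a : H →L[ℂ] H}
    (ha : 0 ≤ a) (ξ : H) :
    IntegrableOn (fun l => l ^ (p - 2) * (inner ℂ ξ ((a * mulResolvent a l) ξ)).re) (Ioi 0) ∧
      (inner ℂ ξ ((a ^ p) ξ)).re = rpowConst p *
        ∫ l in Ioi 0, l ^ (p - 2) * (inner ℂ ξ ((a * mulResolvent a l) ξ)).re := by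
  obtain ⟨h1, h2⟩ := integrableOn_cfc_rpowIntegrand hp ha
  let φ : (H →L[ℂ] H) →L[ℝ] ℝ := Complex.reCLM ∘L
    (((innerSL ℂ ξ) ∘L (ContinuousLinearMap.apply ℂ H ξ)).restrictScalars ℝ)
  have hφ : ∀ T, φ T = (inner ℂ ξ (T ξ)).re := fun T => rfl
  have h3 : ∀ l ∈ Ioi (0 : ℝ), φ (cfc (Real.rpowIntegrand₁₂ p l) a) =
      l ^ (p - 2) * (inner ℂ ξ ((a * mulResolvent a l) ξ)).re := fun l hl => by
    rw [cfc_rpowIntegrand_eq ha hl, map_smul, hφ, smul_eq_mul]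
  refine ⟨(integrableOn_congr_fun h3 measurableSet_Ioi).1 (φ.integrable_comp h1), ?_⟩
  rw [← setIntegral_congr_fun measurableSet_Ioi h3, ← hφ, h2, map_smul, smul_eq_mul,
    φ.integral_comp_comm h1]

end

/-! ### Jensen's inequality for weak integrals -/

section

/-- Superposition of a Carathéodory function with a measurable map; no separability of `E` is
needed, since the range of a strongly measurable map is separable. -/
theorem aestronglyMeasurable_prod_of_continuous {E α β : Type*} [TopologicalSpace E]
    [TopologicalSpace.PseudoMetrizableSpace E]
    [MeasurableSpace α] [MeasurableSpace β] {μ : Measure α} {ν : Measure β} [SFinite μ] [SFinite ν]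
    {Φ : E → α → ℂ} (hc : ∀ t, Continuous fun y => Φ y t)
    (hm : ∀ y, AEStronglyMeasurable (Φ y) μ) {u : β → E} (hu : AEStronglyMeasurable u ν) :
    AEStronglyMeasurable (fun z : β × α => Φ (u z.1) z.2) (ν.prod μ) := by
  have hsimple : ∀ v : SimpleFunc β E,
      AEStronglyMeasurable (fun z : β × α => Φ (v z.1) z.2) (ν.prod μ) := fun v => by
    have h : (fun z : β × α => Φ (v z.1) z.2) = fun z => ∑ y ∈ v.range,
        (Prod.fst ⁻¹' (v ⁻¹' {y})).indicator (fun z : β × α => Φ y z.2) z := by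
      funext z
      rw [Finset.sum_eq_single_of_mem (v z.1) (v.mem_range_self z.1)]
      · rw [indicator_of_mem (by simp)]
      · intro y _ hy
        rw [indicator_of_notMem]
        simpa using fun h => hy h.symm
    rw [h]
    refine Finset.aestronglyMeasurable_fun_sum _ fun y _ => ?_
    exact (hm y).comp_snd.indicator (measurable_fst (v.measurableSet_fiber y))
  have hmk : AEStronglyMeasurable (fun z : β × α => Φ (hu.mk u z.1) z.2) (ν.prod μ) := by
    refine aestronglyMeasurable_of_tendsto_ae Filter.atTop
      (fun n => hsimple (hu.stronglyMeasurable_mk.approx n)) (Filter.Eventually.of_forall ?_)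
    intro z
    exact ((hc z.2).tendsto _).comp (hu.stronglyMeasurable_mk.tendsto_approx z.1)
  refine hmk.congr ?_
  have h := (Measure.quasiMeasurePreserving_fst (μ := ν) (ν := μ)).ae hu.ae_eq_mk
  filter_upwards [h] with z hz
  rw [hz]

variable {H : Type*} [NormedAddCommGroup H] [InnerProductSpace ℂ H]

theorem re_inner_apply_le_norm (A : H →L[ℂ] H) (ξ η : H) :
    (inner ℂ ξ (A η)).re ≤ ‖A‖ * (‖ξ‖ * ‖η‖) := by
  refine (Complex.re_le_norm _).trans ((norm_inner_le_norm _ _).trans ?_)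
  have := A.le_opNorm η
  calc ‖ξ‖ * ‖A η‖ ≤ ‖ξ‖ * (‖A‖ * ‖η‖) := by gcongr
    _ = _ := by ring

/-- The resolvent forms, with the weight `w` as perspective parameter. -/
theorem mul_resolventForm_inv_smul {T : H →L[ℂ] H} {r l : ℝ} (hr : 0 < r) (ξ η : H) :
    r * resolventForm (r⁻¹ • T) l ξ η =
      2 * (inner ℂ η (T ξ)).re - (inner ℂ η (T η)).re - l * r * ‖η‖ ^ 2 := by
  have h : ∀ x : H, (inner ℂ η ((r⁻¹ • T) x)).re = r⁻¹ * (inner ℂ η (T x)).re := fun x => by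
    rw [smul_apply, inner_smul_right_eq_smul, Complex.smul_re, smul_eq_mul]
  rw [resolventForm, h, h]
  field_simp

variable [CompleteSpace H]

section Jensen

variable {α : Type*} [MeasurableSpace α] {μ : Measure α} {f : α → H →L[ℂ] H}
  {A : H →L[ℂ] H} {w : α → ℝ}

/-- The integrand `(l, t) ↦ l ^ (p - 2) * w t * resolventForm (f t / w t) l ξ (ρ l)`, where
`ρ l = mulResolvent A l ξ` is the maximiser belonging to the average `A`. -/
noncomputable def jensenIntegrand (f : α → H →L[ℂ] H) (A : H →L[ℂ] H) (w : α → ℝ) (p : ℝ) (ξ : H)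
    (l : ℝ) (t : α) : ℝ :=
  l ^ (p - 2) * (2 * (inner ℂ (mulResolvent A l ξ) (f t ξ)).re -
    (inner ℂ (mulResolvent A l ξ) (f t (mulResolvent A l ξ))).re -
    l * w t * ‖mulResolvent A l ξ‖ ^ 2)

theorem integrable_jensenIntegrand_section
    (hA : ∀ ξ η : H, Integrable (fun t => inner ℂ ξ (f t η)) μ ∧
      ∫ t, inner ℂ ξ (f t η) ∂μ = inner ℂ ξ (A η))
    (hw : Integrable w μ) (p : ℝ) (ξ : H) (l : ℝ) :
    Integrable (jensenIntegrand f A w p ξ l) μ :=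
  (((((hA _ _).1.re).const_mul 2).sub (hA _ _).1.re).sub
    ((hw.const_mul l).mul_const _)).const_mul _

theorem integral_jensenIntegrand_section
    (hA : ∀ ξ η : H, Integrable (fun t => inner ℂ ξ (f t η)) μ ∧
      ∫ t, inner ℂ ξ (f t η) ∂μ = inner ℂ ξ (A η))
    (hw : Integrable w μ) (hw1 : ∫ t, w t ∂μ = 1) (p : ℝ) (ξ : H) (l : ℝ) :
    ∫ t, jensenIntegrand f A w p ξ l t ∂μ =
      l ^ (p - 2) * resolventForm A l ξ (mulResolvent A l ξ) := by
  have h1 := ((hA (mulResolvent A l ξ) ξ).1.re).const_mul 2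
  have h2 := (hA (mulResolvent A l ξ) (mulResolvent A l ξ)).1.re
  have h3 := (hw.const_mul l).mul_const (‖mulResolvent A l ξ‖ ^ 2)
  simp only [jensenIntegrand]
  rw [integral_const_mul]
  congr 1
  have e1 := integral_sub (h1.sub h2) h3
  have e2 := integral_sub h1 h2
  simp only [Pi.sub_apply] at e1 e2
  refine e1.trans ?_
  rw [e2, integral_const_mul, integral_mul_const, integral_const_mul, hw1, resolventForm, mul_one]
  congr 2
  · congr 1
    exact integral_re_inner (hA _ _)
  · exact integral_re_inner (hA _ _)

theorem aestronglyMeasurable_jensenIntegrand [SFinite μ] (hA0 : 0 ≤ A)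
    (hm : ∀ ξ η : H, AEStronglyMeasurable (fun t => inner ℂ ξ (f t η)) μ)
    (hw : AEStronglyMeasurable w μ) (p : ℝ) (ξ : H) :
    AEStronglyMeasurable (fun z : ℝ × α => jensenIntegrand f A w p ξ z.1 z.2)
      ((volume.restrict (Ioi 0)).prod μ) := by
  have hρ : AEStronglyMeasurable (fun l => mulResolvent A l ξ) (volume.restrict (Ioi (0 : ℝ))) :=
    ((continuousOn_mulResolvent hA0).clm_apply continuousOn_const).aestronglyMeasurable
      measurableSet_Ioi
  have h1 : AEStronglyMeasurable (fun z : ℝ × α => (inner ℂ (mulResolvent A z.1 ξ) (f z.2 ξ) : ℂ))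
      ((volume.restrict (Ioi 0)).prod μ) :=
    aestronglyMeasurable_prod_of_continuous (Φ := fun y t => inner ℂ y (f t ξ))
      (fun t => by fun_prop) (fun y => hm y ξ) hρ
  have h2 : AEStronglyMeasurable (fun z : ℝ × α =>
      (inner ℂ (mulResolvent A z.1 ξ) (f z.2 (mulResolvent A z.1 ξ)) : ℂ))
      ((volume.restrict (Ioi 0)).prod μ) :=
    aestronglyMeasurable_prod_of_continuous (Φ := fun y t => inner ℂ y (f t y))
      (fun t => by fun_prop) (fun y => hm y y) hρ
  have hp : AEStronglyMeasurable (fun z : ℝ × α => z.1 ^ (p - 2))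
      ((volume.restrict (Ioi (0 : ℝ))).prod μ) := by
    have : Measurable fun l : ℝ => l ^ (p - 2) := by fun_prop
    exact (this.comp measurable_fst).aestronglyMeasurable
  have hl : AEStronglyMeasurable (fun z : ℝ × α => z.1)
      ((volume.restrict (Ioi (0 : ℝ))).prod μ) := measurable_fst.aestronglyMeasurable
  exact hp.mul (((Complex.continuous_re.comp_aestronglyMeasurable h1).const_mul 2 |>.sub
    (Complex.continuous_re.comp_aestronglyMeasurable h2)).sub
      ((hl.mul hw.comp_snd).mul (hρ.norm.pow 2).comp_fst))

/-- Since `‖mulResolvent A l‖` is of order `(l + 1)⁻¹`, the inner `L¹` norms are dominated by a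
multiple of `rpowIntegrand₁₂ p l 1 = l ^ (p - 2) / (l + 1)`. Norms of `f t` are never integrated,
only matrix coefficients. -/
theorem integrable_jensenIntegrand [SFinite μ] (hf : ∀ᵐ t ∂μ, 0 ≤ f t)
    (hA : ∀ ξ η : H, Integrable (fun t => inner ℂ ξ (f t η)) μ ∧
      ∫ t, inner ℂ ξ (f t η) ∂μ = inner ℂ ξ (A η))
    (hw0 : ∀ᵐ t ∂μ, 0 < w t) (hw : Integrable w μ) (hw1 : ∫ t, w t ∂μ = 1) {p : ℝ}
    (hp : p ∈ Ioo (1 : ℝ) 2) (ξ : H) :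
    Integrable (fun z : ℝ × α => jensenIntegrand f A w p ξ z.1 z.2)
      ((volume.restrict (Ioi 0)).prod μ) := by
  have hA0 : 0 ≤ A := nonneg_of_integral_inner hf hA
  have hmeas := aestronglyMeasurable_jensenIntegrand hA0
    (fun ξ η => (hA ξ η).1.aestronglyMeasurable) hw.aestronglyMeasurable p ξ
  rw [integrable_prod_iff hmeas]
  refine ⟨Filter.Eventually.of_forall fun l =>
    integrable_jensenIntegrand_section hA hw p ξ l, ?_⟩
  have hquad := integrable_inner_of_quadratic hf (fun ξ η => (hA ξ η).1.aestronglyMeasurable)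
    (fun ξ => (hA ξ ξ).1.re) (C := ‖A‖) (fun ξ => by
      have h := integral_re_inner (hA ξ ξ)
      have h' := re_inner_apply_le_norm A ξ ξ
      rw [← sq] at h'
      exact h.trans_le h')
  set M := 1 + ‖A‖ with hM
  set N := M * ‖ξ‖ with hN
  have hA' : 0 ≤ ‖A‖ := norm_nonneg A
  have hM0 : 0 < M := by positivity
  have hN0 : 0 ≤ N := by positivity
  have hdom : IntegrableOn (fun l : ℝ => (2 * ‖A‖ * N * ‖ξ‖ + ‖A‖ * N ^ 2 + N ^ 2) *
      Real.rpowIntegrand₁₂ p l 1) (Ioi 0) :=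
    (Real.integrableOn_rpowIntegrand₁₂ hp zero_le_one).const_mul _
  refine hdom.mono' hmeas.norm.integral_prod_right' ?_
  filter_upwards [ae_restrict_mem measurableSet_Ioi] with l (hl : 0 < l)
  rw [Real.norm_of_nonneg (integral_nonneg fun _ => norm_nonneg _)]
  set ρ := mulResolvent A l ξ with hρdef
  have hρ : ‖ρ‖ ≤ N * (l + 1)⁻¹ := by
    calc ‖ρ‖ ≤ ‖mulResolvent A l‖ * ‖ξ‖ := ContinuousLinearMap.le_opNorm _ _
      _ ≤ (M / (l + 1)) * ‖ξ‖ := by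
        gcongr
        exact norm_mulResolvent_le hA0 hl
      _ = N * (l + 1)⁻¹ := by rw [hN]; ring
  have hl1 : (l + 1)⁻¹ ≤ 1 := inv_le_one_of_one_le₀ (by linarith)
  have hl1' : 0 < (l + 1)⁻¹ := by positivity
  have hρ2 : ‖ρ‖ ^ 2 ≤ N ^ 2 * (l + 1)⁻¹ := by
    calc ‖ρ‖ ^ 2 ≤ (N * (l + 1)⁻¹) ^ 2 := by gcongr
      _ = N ^ 2 * (l + 1)⁻¹ * (l + 1)⁻¹ := by ring
      _ ≤ N ^ 2 * (l + 1)⁻¹ * 1 := by gcongr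
      _ = _ := mul_one _
  have hρ3 : l * ‖ρ‖ ^ 2 ≤ N ^ 2 * (l + 1)⁻¹ := by
    calc l * ‖ρ‖ ^ 2 ≤ (l + 1) * (N * (l + 1)⁻¹) ^ 2 := by
          gcongr
          linarith
      _ = N ^ 2 * (l + 1)⁻¹ := by field_simp
  have hint : Real.rpowIntegrand₁₂ p l 1 = l ^ (p - 2) * (l + 1)⁻¹ := by
    have h2 : l ^ (p - 1) = l ^ (p - 2) * l := by
      rw [← Real.rpow_add_one hl.ne']
      ring_nf
    rw [Real.rpowIntegrand₁₂, h2]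
    field_simp
    ring
  have h1 := hquad ρ ξ
  have h2 := hquad ρ ρ
  have hb : ∀ᵐ t ∂μ, ‖jensenIntegrand f A w p ξ l t‖ ≤ l ^ (p - 2) *
      ((2 * ‖(inner ℂ ρ (f t ξ) : ℂ)‖ + ‖(inner ℂ ρ (f t ρ) : ℂ)‖) + l * ‖ρ‖ ^ 2 * w t) := by
    filter_upwards [hw0] with t ht
    have hlp : 0 ≤ l ^ (p - 2) := by positivity
    rw [jensenIntegrand, norm_mul, Real.norm_of_nonneg hlp]
    gcongr
    have e1 := abs_le.1 (Complex.abs_re_le_norm (inner ℂ ρ (f t ξ)))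
    have e2 := abs_le.1 (Complex.abs_re_le_norm (inner ℂ ρ (f t ρ)))
    have e3 : 0 ≤ l * w t * ‖ρ‖ ^ 2 := by positivity
    rw [Real.norm_eq_abs, abs_le]
    constructor <;> linarith [e1.1, e1.2, e2.1, e2.2]
  have hbi : Integrable (fun t => 2 * ‖(inner ℂ ρ (f t ξ) : ℂ)‖ +
      ‖(inner ℂ ρ (f t ρ) : ℂ)‖) μ := (h1.1.norm.const_mul 2).add h2.1.norm
  calc ∫ t, ‖jensenIntegrand f A w p ξ l t‖ ∂μ
      ≤ ∫ t, l ^ (p - 2) * ((2 * ‖(inner ℂ ρ (f t ξ) : ℂ)‖ + ‖(inner ℂ ρ (f t ρ) : ℂ)‖) +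
          l * ‖ρ‖ ^ 2 * w t) ∂μ :=
        integral_mono_ae (integrable_jensenIntegrand_section hA hw p ξ l).norm
          ((hbi.add (hw.const_mul _)).const_mul _) hb
    _ = l ^ (p - 2) * ((2 * ∫ t, ‖(inner ℂ ρ (f t ξ) : ℂ)‖ ∂μ +
          ∫ t, ‖(inner ℂ ρ (f t ρ) : ℂ)‖ ∂μ) + l * ‖ρ‖ ^ 2) := by
        rw [integral_const_mul, integral_add hbi (hw.const_mul _),
          integral_add (h1.1.norm.const_mul 2) h2.1.norm, integral_const_mul, integral_const_mul,
          hw1, mul_one]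
    _ ≤ l ^ (p - 2) * ((2 * (‖A‖ * (N * (l + 1)⁻¹ * ‖ξ‖)) + ‖A‖ * (N ^ 2 * (l + 1)⁻¹)) +
          N ^ 2 * (l + 1)⁻¹) := by
        have g1 : ∫ t, ‖(inner ℂ ρ (f t ξ) : ℂ)‖ ∂μ ≤ ‖A‖ * (N * (l + 1)⁻¹ * ‖ξ‖) :=
          h1.2.trans (by gcongr)
        have g2 : ∫ t, ‖(inner ℂ ρ (f t ρ) : ℂ)‖ ∂μ ≤ ‖A‖ * (N ^ 2 * (l + 1)⁻¹) :=
          h2.2.trans (by rw [← sq]; gcongr)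
        gcongr
    _ = (2 * ‖A‖ * N * ‖ξ‖ + ‖A‖ * N ^ 2 + N ^ 2) * Real.rpowIntegrand₁₂ p l 1 := by
        rw [hint]
        ring

theorem rpow_inv_smul_mul {T : H →L[ℂ] H} (hT : 0 ≤ T) {r p : ℝ} (hr : 0 < r) (hp : 0 ≤ p)
    (ξ : H) :
    r * (inner ℂ ξ (((r⁻¹ • T) ^ p) ξ)).re = r ^ (1 - p) * (inner ℂ ξ ((T ^ p) ξ)).re := by
  rw [rpow_smul_of_nonneg hT (inv_nonneg.2 hr.le) hp, smul_apply,
    inner_smul_right_eq_smul, Complex.smul_re, smul_eq_mul, ← mul_assoc,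
    Real.inv_rpow hr.le, Real.rpow_sub hr, Real.rpow_one, div_eq_mul_inv]

theorem re_inner_rpow_two {T : H →L[ℂ] H} (hT : 0 ≤ T) (ξ : H) :
    (inner ℂ ξ ((T ^ (2 : ℝ)) ξ)).re = ‖T ξ‖ ^ 2 := by
  have h : T ^ (2 : ℝ) = T ^ (2 : ℕ) := by
    exact_mod_cast CFC.rpow_natCast T 2 hT
  rw [h, pow_two, mul_apply_eq_comp,
    ← ((ContinuousLinearMap.nonneg_iff_isPositive T).1 hT).inner_left_eq_inner_right,
    inner_self_eq_norm_sq_to_K]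
  norm_cast

/-- Jensen's inequality for the weak integral and the operator convex function `x ↦ x ^ p`,
`1 < p ≤ 2`, in perspective form: the average `∫ (f / w) w` is taken with respect to the
probability density `w`. -/
theorem re_inner_rpow_le_integral [SFinite μ] (hf : ∀ᵐ t ∂μ, 0 ≤ f t)
    (hA : ∀ ξ η : H, Integrable (fun t => inner ℂ ξ (f t η)) μ ∧
      ∫ t, inner ℂ ξ (f t η) ∂μ = inner ℂ ξ (A η))
    (hw0 : ∀ᵐ t ∂μ, 0 < w t) (hw : Integrable w μ) (hw1 : ∫ t, w t ∂μ = 1) {p : ℝ}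
    (hp1 : 1 < p) (hp2 : p ≤ 2) (ξ : H)
    (hi : Integrable (fun t => w t ^ (1 - p) * (inner ℂ ξ ((f t ^ p) ξ)).re) μ) :
    (inner ℂ ξ ((A ^ p) ξ)).re ≤ ∫ t, w t ^ (1 - p) * (inner ℂ ξ ((f t ^ p) ξ)).re ∂μ := by
  have hA0 : 0 ≤ A := nonneg_of_integral_inner hf hA
  rcases hp2.lt_or_eq with hp2 | rfl
  · -- Fubini's theorem applied to `jensenIntegrand`: integrating over `t` first gives `A ^ p`,
    -- integrating over `l` first gives a lower bound for the right-hand side.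
    have hp : p ∈ Ioo (1 : ℝ) 2 := ⟨hp1, hp2⟩
    have hJ := integrable_jensenIntegrand hf hA hw0 hw hw1 hp ξ
    have hK := rpowConst_nonneg hp
    rw [(re_inner_rpow_eq_integral hp hA0 ξ).2]
    have h1 : ∫ l in Ioi 0, l ^ (p - 2) * (inner ℂ ξ ((A * mulResolvent A l) ξ)).re =
        ∫ l in Ioi 0, ∫ t, jensenIntegrand f A w p ξ l t ∂μ := by
      refine setIntegral_congr_fun measurableSet_Ioi fun l hl => ?_
      rw [integral_jensenIntegrand_section hA hw hw1, resolventForm_mulResolvent hA0 hl]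
    rw [h1, integral_integral_swap hJ, ← integral_const_mul]
    refine integral_mono_ae (hJ.integral_prod_right.const_mul _) hi ?_
    filter_upwards [hf, hw0, hJ.prod_left_ae] with t ht htw hti
    have hT : 0 ≤ (w t)⁻¹ • f t := smul_nonneg (inv_nonneg.2 htw.le) ht
    obtain ⟨hr1, hr2⟩ := re_inner_rpow_eq_integral hp hT ξ
    rw [← rpow_inv_smul_mul ht htw (by linarith), hr2, mul_left_comm]
    refine mul_le_mul_of_nonneg_left ?_ hK
    rw [← integral_const_mul]
    refine setIntegral_mono_on hti (hr1.const_mul _) measurableSet_Ioi fun l hl => ?_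
    have hl' : 0 < l := hl
    have hlp : 0 ≤ l ^ (p - 2) := by positivity
    rw [jensenIntegrand, ← mul_resolventForm_inv_smul htw, mul_left_comm (w t)]
    gcongr
    exact resolventForm_le hT hl ξ _
  · -- For `p = 2` the affine minorant is the tangent `2 re ⟪A ξ, X ξ⟫ - ‖A ξ‖ ^ 2` of `‖X ξ‖ ^ 2`.
    have h1 := ((hA (A ξ) ξ).1.re).const_mul 2
    have h2 := hw.mul_const (‖A ξ‖ ^ 2)
    have h3 : ∫ t, (2 * (inner ℂ (A ξ) (f t ξ)).re - w t * ‖A ξ‖ ^ 2) ∂μ = ‖A ξ‖ ^ 2 := by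
      refine (integral_sub h1 h2).trans ?_
      rw [integral_const_mul, integral_mul_const, hw1]
      have h4 := integral_re_inner (hA (A ξ) ξ)
      have h5 : (inner ℂ (A ξ) (A ξ)).re = ‖A ξ‖ ^ 2 := by
        rw [inner_self_eq_norm_sq_to_K]
        norm_cast
      rw [h5] at h4
      change 2 * ∫ t, (inner ℂ (A ξ) (f t ξ)).re ∂μ - _ = _
      rw [h4]
      ring
    rw [re_inner_rpow_two hA0, ← h3]
    refine integral_mono_ae (h1.sub h2) hi ?_
    filter_upwards [hf, hw0] with t ht htw
    rw [re_inner_rpow_two ht]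
    have h4 : (inner ℂ (A ξ) (f t ξ)).re ≤ ‖A ξ‖ * ‖f t ξ‖ :=
      (Complex.re_le_norm _).trans (norm_inner_le_norm _ _)
    have h5 : w t ^ ((1 : ℝ) - 2) = (w t)⁻¹ := by
      rw [← Real.rpow_neg_one]
      norm_num
    rw [h5]
    have h6 : 0 ≤ (w t)⁻¹ * (‖f t ξ‖ - w t * ‖A ξ‖) ^ 2 := by positivity
    have h7 : (w t)⁻¹ * (‖f t ξ‖ - w t * ‖A ξ‖) ^ 2 =
        (w t)⁻¹ * ‖f t ξ‖ ^ 2 - 2 * (‖A ξ‖ * ‖f t ξ‖) + w t * ‖A ξ‖ ^ 2 := by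
      field_simp
      ring
    change 2 * (inner ℂ (A ξ) (f t ξ)).re - w t * ‖A ξ‖ ^ 2 ≤ _
    linarith

end Jensen

end

/-! ### Hardy's inequality -/

section

/-- Tonelli's theorem for the kernel `x ^ (-1 - c) * t ^ c` on `t ≤ x`, whose integral over `x`
is `c⁻¹` for every `t`. -/
theorem integral_rpow_mul_integral_Ioc {φ : ℝ → ℝ} (hφ : IntegrableOn φ (Ioi 0)) {c : ℝ}
    (hc : 0 < c) :
    IntegrableOn (fun x => x ^ (-1 - c) * ∫ t in Ioc 0 x, t ^ c * φ t) (Ioi 0) ∧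
      ∫ x in Ioi 0, x ^ (-1 - c) * ∫ t in Ioc 0 x, t ^ c * φ t = c⁻¹ * ∫ t in Ioi 0, φ t := by
  let K : ℝ → ℝ → ℝ := fun x t => {z : ℝ × ℝ | z.2 ≤ z.1}.indicator (fun z => z.1 ^ (-1 - c)) (x, t)
    * (t ^ c * φ t)
  have hset : MeasurableSet {z : ℝ × ℝ | z.2 ≤ z.1} :=
    measurableSet_le measurable_snd measurable_fst
  have hKm : AEStronglyMeasurable (Function.uncurry K)
      ((volume.restrict (Ioi (0 : ℝ))).prod (volume.restrict (Ioi (0 : ℝ)))) := by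
    have h1 : Measurable ({z : ℝ × ℝ | z.2 ≤ z.1}.indicator fun z => z.1 ^ (-1 - c)) :=
      Measurable.indicator (by fun_prop) hset
    have h2 : Measurable fun t : ℝ => t ^ c := by fun_prop
    exact h1.aestronglyMeasurable.mul
      (h2.aestronglyMeasurable.mul hφ.aestronglyMeasurable).comp_snd
  have hker : ∀ t : ℝ, (fun x : ℝ => {z : ℝ × ℝ | z.2 ≤ z.1}.indicator
      (fun z => z.1 ^ (-1 - c)) (x, t)) = (Ici t).indicator fun x => x ^ (-1 - c) := fun t => by
    funext x
    simp [indicator_apply]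
  have hki : ∀ t ∈ Ioi (0 : ℝ), IntegrableOn ((Ici t).indicator fun x : ℝ => x ^ (-1 - c))
      (Ioi 0) := fun t ht => by
    have h : IntegrableOn (fun x : ℝ => x ^ (-1 - c)) (Ici t) := by
      rw [integrableOn_Ici_iff_integrableOn_Ioi]
      exact integrableOn_Ioi_rpow_of_lt (by linarith) ht
    exact (h.integrable_indicator measurableSet_Ici).integrableOn
  have hkv : ∀ t ∈ Ioi (0 : ℝ), ∫ x in Ioi 0, (Ici t).indicator (fun x : ℝ => x ^ (-1 - c)) x =
      c⁻¹ * t ^ (-c) := fun t (ht : 0 < t) => by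
    rw [setIntegral_indicator measurableSet_Ici,
      inter_eq_self_of_subset_right (Ici_subset_Ioi.2 ht),
      integral_Ici_eq_integral_Ioi, integral_Ioi_rpow_of_lt (by linarith) ht]
    ring_nf
  have hKt : ∀ t ∈ Ioi (0 : ℝ), Integrable (fun x => K x t) (volume.restrict (Ioi 0)) ∧
      ∀ r : ℝ, ∫ x in Ioi 0, (Ici t).indicator (fun x : ℝ => x ^ (-1 - c)) x * (t ^ c * r) =
        c⁻¹ * r := fun t ht => by
    constructor
    · have h := (hki t ht).mul_const (t ^ c * φ t)
      rwa [← hker] at h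
    · intro r
      have ht' : 0 < t := ht
      rw [integral_mul_const, hkv t ht, Real.rpow_neg ht'.le]
      field_simp
  have hKi : Integrable (Function.uncurry K)
      ((volume.restrict (Ioi (0 : ℝ))).prod (volume.restrict (Ioi (0 : ℝ)))) := by
    rw [integrable_prod_iff' hKm]
    refine ⟨?_, ?_⟩
    · filter_upwards [ae_restrict_mem measurableSet_Ioi] with t ht using (hKt t ht).1
    · refine (hφ.norm.const_mul c⁻¹).congr ?_
      filter_upwards [ae_restrict_mem measurableSet_Ioi] with t (ht : 0 < t)
      rw [← (hKt t ht).2 ‖φ t‖]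
      refine setIntegral_congr_fun measurableSet_Ioi fun x (hx : 0 < x) => ?_
      have h := congrFun (hker t) x
      simp only [Function.uncurry_apply_pair, K]
      rw [h, norm_mul, norm_mul, Real.norm_of_nonneg (by positivity : 0 ≤ t ^ c),
        Real.norm_of_nonneg (indicator_apply_nonneg fun _ => by positivity)]
  have hKx : ∀ x : ℝ, ∫ t in Ioi 0, K x t = x ^ (-1 - c) * ∫ t in Ioc 0 x, t ^ c * φ t :=
    fun x => by
    have h : ∀ t, K x t = (Iic x).indicator (fun t => x ^ (-1 - c) * (t ^ c * φ t)) t := fun t => by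
      by_cases htx : t ≤ x <;> simp [K, indicator_apply, htx]
    simp only [h]
    rw [setIntegral_indicator measurableSet_Iic, Ioi_inter_Iic, integral_const_mul]
  constructor
  · have h := hKi.integral_prod_left
    simp only [Function.uncurry_apply_pair, hKx] at h
    exact h
  · simp only [← hKx]
    rw [integral_integral_swap hKi, ← integral_const_mul]
    refine setIntegral_congr_fun measurableSet_Ioi fun t ht => ?_
    rw [← (hKt t ht).2 (φ t)]
    refine integral_congr_ae (Filter.Eventually.of_forall fun x => ?_)
    have h := congrFun (hker t) x
    simp only [K]
    rw [h]

variable {H : Type*} [NormedAddCommGroup H] [InnerProductSpace ℂ H]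

theorem hasWeakIntegral_Ioc_sub {f : ℝ → H →L[ℂ] H} {x y : ℝ} (hx : 0 ≤ x) (hxy : x ≤ y)
    {S R : H →L[ℂ] H}
    (hS : HasWeakIntegral f (Ioc 0 x) S) (hR : HasWeakIntegral f (Ioc 0 y) R) :
    HasWeakIntegral f (Ioc x y) (R - S) := fun ξ η => by
  have hi := (hR ξ η).1.mono_set (Ioc_subset_Ioc_left hx)
  refine ⟨hi, ?_⟩
  have hd : Disjoint (Ioc 0 x) (Ioc x y) := Ioc_disjoint_Ioc_of_le le_rfl
  have h := setIntegral_union hd measurableSet_Ioc (hS ξ η).1 hi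
  rw [Ioc_union_Ioc_eq_Ioc hx hxy, (hR ξ η).2, (hS ξ η).2] at h
  rw [sub_apply, inner_sub_right, h]
  ring

theorem HasWeakIntegral.nonneg {g : ℝ → H →L[ℂ] H} {s : Set ℝ} {T : H →L[ℂ] H}
    (hT : HasWeakIntegral g s T) (hs : MeasurableSet s) (hg : ∀ x ∈ s, 0 ≤ g x) : 0 ≤ T :=
  nonneg_of_integral_inner ((ae_restrict_mem hs).mono hg) hT

theorem HasWeakIntegral.integral_re {g : ℝ → H →L[ℂ] H} {s : Set ℝ} {T : H →L[ℂ] H}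
    (hT : HasWeakIntegral g s T) (ξ η : H) :
    ∫ x in s, (inner ℂ ξ (g x η)).re = (inner ℂ ξ (T η)).re :=
  integral_re_inner (hT ξ η)

variable [CompleteSpace H]

theorem norm_le_of_re_inner_le {D : H →L[ℂ] H} (hD : 0 ≤ D) {C : ℝ} (hC : 0 ≤ C)
    (h : ∀ ξ : H, (inner ℂ ξ (D ξ)).re ≤ C * ‖ξ‖ ^ 2) : ‖D‖ ≤ C := by
  rw [CStarAlgebra.norm_le_iff_le_algebraMap D hC hD, Algebra.algebraMap_eq_smul_one]
  refine (le_iff_re_inner_le hD (smul_nonneg hC zero_le_one)).2 fun ξ => (h ξ).trans_eq ?_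
  rw [smul_apply, inner_smul_right_eq_smul, Complex.smul_re, one_apply_eq_self,
    inner_self_eq_norm_sq_to_K, smul_eq_mul]
  norm_cast

section Hardy

variable {f : ℝ → H →L[ℂ] H} {p : ℝ} {T : H →L[ℂ] H}

theorem setIntegral_re_inner_rpow_le (hT : HasWeakIntegral (fun x => f x ^ p) (Ioi 0) T) (ξ : H)
    {s : Set ℝ} (hs0 : s ⊆ Ioi 0) :
    ∫ t in s, (inner ℂ ξ ((f t ^ p) ξ)).re ≤ ‖T‖ * ‖ξ‖ ^ 2 := by
  have h1 : ∫ t in s, (inner ℂ ξ ((f t ^ p) ξ)).re ≤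
      ∫ t in Ioi 0, (inner ℂ ξ ((f t ^ p) ξ)).re :=
    setIntegral_mono_set (hT ξ ξ).1.re
      (Filter.Eventually.of_forall fun t => re_inner_nonneg_of_nonneg CFC.rpow_nonneg ξ)
      hs0.eventuallyLE
  have h2 := integral_re_inner (hT ξ ξ)
  have h3 := re_inner_apply_le_norm T ξ ξ
  rw [← sq] at h3
  exact h1.trans (h2.trans_le h3)

/-- Integrated form of `le_smul_one_add_rpow`. -/
theorem integrableOn_re_inner_of_rpow (hp : 1 ≤ p) (hf : ∀ x ∈ Ioi (0 : ℝ), 0 ≤ f x)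
    (hm : WeaklyMeasurable f) (hT : HasWeakIntegral (fun x => f x ^ p) (Ioi 0) T) {s : Set ℝ}
    (hs : MeasurableSet s) (hs0 : s ⊆ Ioi 0) (hsv : volume s ≠ ⊤) {δ : ℝ} (hδ : 0 < δ) (ξ : H) :
    IntegrableOn (fun t => (inner ℂ ξ (f t ξ)).re) s ∧
      ∫ t in s, (inner ℂ ξ (f t ξ)).re ≤
        (δ * volume.real s + δ ^ (1 - p) * ‖T‖) * ‖ξ‖ ^ 2 := by
  have hpi : IntegrableOn (fun t => (inner ℂ ξ ((f t ^ p) ξ)).re) s :=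
    ((hT ξ ξ).1.mono_set hs0).re
  have hci : IntegrableOn (fun _ : ℝ => δ * ‖ξ‖ ^ 2) s := integrableOn_const hsv
  have hb : ∀ t ∈ s, (inner ℂ ξ (f t ξ)).re ≤
      δ * ‖ξ‖ ^ 2 + δ ^ (1 - p) * (inner ℂ ξ ((f t ^ p) ξ)).re := fun t ht => by
    have hft := hf t (hs0 ht)
    have hle := le_smul_one_add_rpow hft hp hδ
    have h := (le_iff_re_inner_le hft (hft.trans hle)).1 hle ξ
    refine h.trans_eq ?_
    rw [add_apply, inner_add_right, smul_apply, smul_apply, inner_smul_right_eq_smul,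
      inner_smul_right_eq_smul, Complex.add_re, Complex.smul_re, Complex.smul_re,
      one_apply_eq_self, inner_self_eq_norm_sq_to_K, smul_eq_mul, smul_eq_mul]
    norm_cast
  have hbi : IntegrableOn (fun t => δ * ‖ξ‖ ^ 2 +
      δ ^ (1 - p) * (inner ℂ ξ ((f t ^ p) ξ)).re) s := hci.add (hpi.const_mul _)
  have hi : IntegrableOn (fun t => (inner ℂ ξ (f t ξ)).re) s := by
    refine hbi.mono' (Complex.continuous_re.comp_aestronglyMeasurable
      ((hm ξ ξ).mono_measure (Measure.restrict_mono hs0 le_rfl))) ?_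
    filter_upwards [ae_restrict_mem hs] with t ht
    rw [Real.norm_of_nonneg (re_inner_nonneg_of_nonneg (hf t (hs0 ht)) ξ)]
    exact hb t ht
  refine ⟨hi, ?_⟩
  calc ∫ t in s, (inner ℂ ξ (f t ξ)).re
      ≤ ∫ t in s, (δ * ‖ξ‖ ^ 2 + δ ^ (1 - p) * (inner ℂ ξ ((f t ^ p) ξ)).re) :=
        setIntegral_mono_on hi hbi hs hb
    _ = volume.real s * (δ * ‖ξ‖ ^ 2) +
          δ ^ (1 - p) * ∫ t in s, (inner ℂ ξ ((f t ^ p) ξ)).re := by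
        rw [integral_add hci (hpi.const_mul _), setIntegral_const, integral_const_mul, smul_eq_mul]
    _ ≤ volume.real s * (δ * ‖ξ‖ ^ 2) + δ ^ (1 - p) * (‖T‖ * ‖ξ‖ ^ 2) := by
        gcongr
        exact setIntegral_re_inner_rpow_le hT ξ hs0
    _ = _ := by ring

theorem hasWeakIntegral_weakIntegral_Ioc (hp : 1 ≤ p) (hf : ∀ x ∈ Ioi (0 : ℝ), 0 ≤ f x)
    (hm : WeaklyMeasurable f) (hT : HasWeakIntegral (fun x => f x ^ p) (Ioi 0) T) (x : ℝ) :
    HasWeakIntegral f (Ioc 0 x) (weakIntegral f (Ioc 0 x)) := by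
  have h := fun ξ => integrableOn_re_inner_of_rpow hp hf hm hT (measurableSet_Ioc (a := 0) (b := x))
    (fun t ht => ht.1) measure_Ioc_lt_top.ne one_pos ξ
  obtain ⟨S, hS⟩ := exists_operator_of_quadratic (μ := volume.restrict (Ioc 0 x)) (g := f)
    ((ae_restrict_mem measurableSet_Ioc).mono fun t ht => hf t ht.1)
    (fun ξ η => (hm ξ η).mono_measure (Measure.restrict_mono (fun t ht => ht.1) le_rfl))
    (fun ξ => (h ξ).1) (fun ξ => (h ξ).2)
  have hS' : HasWeakIntegral f (Ioc 0 x) S := hS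
  rwa [hS'.weakIntegral_eq]

/-- Hölder's inequality: the primitive of `f` is norm continuous, although `f` itself is only
weakly measurable. The parameter `δ = (y - x) ^ (-1 / p)` balances the two terms of
`integrableOn_re_inner_of_rpow`. -/
theorem norm_weakIntegral_Ioc_sub_le (hp : 1 < p) (hf : ∀ x ∈ Ioi (0 : ℝ), 0 ≤ f x)
    (hm : WeaklyMeasurable f) (hT : HasWeakIntegral (fun x => f x ^ p) (Ioi 0) T) {x y : ℝ}
    (hx : 0 < x) (hxy : x < y) :
    ‖weakIntegral f (Ioc 0 y) - weakIntegral f (Ioc 0 x)‖ ≤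
      (1 + ‖T‖) * (y - x) ^ (1 - 1 / p) := by
  have hD := hasWeakIntegral_Ioc_sub hx.le hxy.le
    (hasWeakIntegral_weakIntegral_Ioc hp.le hf hm hT x)
    (hasWeakIntegral_weakIntegral_Ioc hp.le hf hm hT y)
  have hyx : 0 < y - x := sub_pos.2 hxy
  have hs0 : Ioc x y ⊆ Ioi 0 := fun t ht => hx.trans ht.1
  refine norm_le_of_re_inner_le (nonneg_of_integral_inner
    ((ae_restrict_mem measurableSet_Ioc).mono fun t ht => hf t (hs0 ht)) hD) (by positivity)
    fun ξ => ?_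
  have h := (integrableOn_re_inner_of_rpow hp.le hf hm hT measurableSet_Ioc hs0
    measure_Ioc_lt_top.ne (Real.rpow_pos_of_pos hyx (-(1 / p))) ξ).2
  rw [integral_re_inner (hD ξ ξ), Real.volume_real_Ioc_of_le hxy.le, ← Real.rpow_mul hyx.le,
    ← Real.rpow_add_one hyx.ne'] at h
  refine h.trans_eq ?_
  have e1 : -(1 / p) + 1 = 1 - 1 / p := by ring
  have e2 : -(1 / p) * (1 - p) = 1 - 1 / p := by
    field_simp
    ring
  rw [e1, e2]
  ring

theorem continuousOn_weakIntegral_Ioc (hp : 1 < p) (hf : ∀ x ∈ Ioi (0 : ℝ), 0 ≤ f x)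
    (hm : WeaklyMeasurable f) (hT : HasWeakIntegral (fun x => f x ^ p) (Ioi 0) T) :
    ContinuousOn (fun x => weakIntegral f (Ioc 0 x)) (Ioi 0) := by
  have hc : 0 < 1 - 1 / p := by
    have : 1 / p < 1 := (div_lt_one (by linarith)).2 hp
    linarith
  have hlip : ∀ x ∈ Ioi (0 : ℝ), ∀ y ∈ Ioi (0 : ℝ),
      ‖weakIntegral f (Ioc 0 y) - weakIntegral f (Ioc 0 x)‖ ≤
        (1 + ‖T‖) * |y - x| ^ (1 - 1 / p) := by
    intro x hx y hy
    rcases lt_trichotomy x y with h | rfl | h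
    · rw [abs_of_pos (sub_pos.2 h)]
      exact norm_weakIntegral_Ioc_sub_le hp hf hm hT hx h
    · rw [sub_self, sub_self, norm_zero, abs_zero, Real.zero_rpow hc.ne', mul_zero]
    · rw [norm_sub_rev, abs_sub_comm, abs_of_pos (sub_pos.2 h)]
      exact norm_weakIntegral_Ioc_sub_le hp hf hm hT hy h
  intro x hx
  rw [ContinuousWithinAt, tendsto_iff_norm_sub_tendsto_zero]
  have ht : Filter.Tendsto (fun y : ℝ => (1 + ‖T‖) * |y - x| ^ (1 - 1 / p))
      (nhdsWithin x (Ioi 0)) (nhds 0) := by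
    have : Continuous fun y : ℝ => (1 + ‖T‖) * |y - x| ^ (1 - 1 / p) :=
      continuous_const.mul ((by fun_prop : Continuous fun y : ℝ => |y - x|).rpow_const
        fun _ => Or.inr hc.le)
    have h := this.tendsto x
    simp only [sub_self, abs_zero, Real.zero_rpow hc.ne', mul_zero] at h
    exact h.mono_left nhdsWithin_le_nhds
  refine squeeze_zero' (Filter.Eventually.of_forall fun _ => norm_nonneg _) ?_ ht
  filter_upwards [self_mem_nhdsWithin] with y hy using hlip x hx y hy

theorem hardyAverage_nonneg (hp : 1 ≤ p) (hf : ∀ x ∈ Ioi (0 : ℝ), 0 ≤ f x)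
    (hm : WeaklyMeasurable f) (hT : HasWeakIntegral (fun x => f x ^ p) (Ioi 0) T) {x : ℝ}
    (hx : 0 < x) : 0 ≤ hardyAverage f x :=
  smul_nonneg (by positivity) (nonneg_of_integral_inner
    ((ae_restrict_mem measurableSet_Ioc).mono fun t ht => hf t ht.1)
    (hasWeakIntegral_weakIntegral_Ioc hp hf hm hT x))

theorem continuousOn_hardyAverage_rpow (hp : 1 < p) (hf : ∀ x ∈ Ioi (0 : ℝ), 0 ≤ f x)
    (hm : WeaklyMeasurable f) (hT : HasWeakIntegral (fun x => f x ^ p) (Ioi 0) T) :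
    ContinuousOn (fun x => hardyAverage f x ^ p) (Ioi 0) := by
  have h1 : ContinuousOn (hardyAverage f) (Ioi 0) :=
    (continuousOn_const.div continuousOn_id fun x hx => ne_of_gt hx).smul
      (continuousOn_weakIntegral_Ioc hp hf hm hT)
  exact ContinuousOn.cfc_nnreal_of_mem_nhdsSet (s := univ) _ Filter.univ_mem h1
    (fun x hx => hardyAverage_nonneg hp.le hf hm hT hx)
    (NNReal.continuous_rpow_const (by linarith)).continuousOn

/-- Jensen's inequality on `(0, x]` for the probability density `c x ^ (-c) t ^ (c - 1)`,
`c = 1 - 1 / p`. This weight makes the resulting bound integrate to the sharp constant. -/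
theorem re_inner_hardyAverage_rpow_le (hp1 : 1 < p) (hp2 : p ≤ 2)
    (hf : ∀ x ∈ Ioi (0 : ℝ), 0 ≤ f x) (hm : WeaklyMeasurable f)
    (hT : HasWeakIntegral (fun x => f x ^ p) (Ioi 0) T) {x : ℝ} (hx : 0 < x) (ξ : H) :
    (inner ℂ ξ ((hardyAverage f x ^ p) ξ)).re ≤ (1 - 1 / p) ^ (1 - p) *
      (x ^ (-1 - (1 - 1 / p)) *
        ∫ t in Ioc 0 x, t ^ (1 - 1 / p) * (inner ℂ ξ ((f t ^ p) ξ)).re) := by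
  have hp0 : 0 < p := by linarith
  obtain ⟨c, hcdef⟩ : ∃ c, c = 1 - 1 / p := ⟨_, rfl⟩
  have hc : 0 < c := by
    have : 1 / p < 1 := (div_lt_one hp0).2 hp1
    linarith
  rw [← hcdef]
  have hF := hasWeakIntegral_weakIntegral_Ioc hp1.le hf hm hT x
  have hfx : ∀ᵐ t ∂volume.restrict (Ioc 0 x), 0 ≤ f t :=
    (ae_restrict_mem measurableSet_Ioc).mono fun t ht => hf t ht.1
  have hF0 : 0 ≤ weakIntegral f (Ioc 0 x) := nonneg_of_integral_inner hfx hF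
  let w : ℝ → ℝ := fun t => c * x ^ (-c) * t ^ (c - 1)
  have hwint : IntegrableOn (fun t : ℝ => t ^ (c - 1)) (Ioc 0 x) :=
    (intervalIntegrable_iff_integrableOn_Ioc_of_le hx.le).1
      (intervalIntegral.intervalIntegrable_rpow' (by linarith))
  have hw1 : ∫ t in Ioc 0 x, w t = 1 := by
    simp only [w]
    rw [integral_const_mul, ← intervalIntegral.integral_of_le hx.le,
      integral_rpow (Or.inl (by linarith)), sub_add_cancel, Real.zero_rpow hc.ne',
      Real.rpow_neg hx.le]
    have := (Real.rpow_pos_of_pos hx c).ne'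
    field_simp
    ring
  have hwp : ∀ t ∈ Ioc 0 x, w t ^ (1 - p) = c ^ (1 - p) * x ^ (c * (p - 1)) * t ^ c :=
    fun t ht => by
    have ht0 : 0 < t := ht.1
    simp only [w]
    rw [Real.mul_rpow (by positivity) (by positivity), Real.mul_rpow hc.le (by positivity),
      ← Real.rpow_mul hx.le, ← Real.rpow_mul ht0.le]
    have e1 : -c * (1 - p) = c * (p - 1) := by ring
    have e2 : (c - 1) * (1 - p) = c := by
      rw [hcdef]
      field_simp
      ring
    rw [e1, e2]
  have hφi : IntegrableOn (fun t => t ^ c * (inner ℂ ξ ((f t ^ p) ξ)).re) (Ioc 0 x) := by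
    have h0 : IntegrableOn (fun t => (inner ℂ ξ ((f t ^ p) ξ)).re) (Ioc 0 x) :=
      ((hT ξ ξ).1.mono_set fun t ht => ht.1).re
    refine h0.bdd_mul (c := x ^ c) (by fun_prop) ?_
    filter_upwards [ae_restrict_mem measurableSet_Ioc] with t ht
    rw [Real.norm_of_nonneg (Real.rpow_nonneg ht.1.le c)]
    exact Real.rpow_le_rpow ht.1.le ht.2 hc.le
  have heq : ∀ t ∈ Ioc 0 x, w t ^ (1 - p) * (inner ℂ ξ ((f t ^ p) ξ)).re =
      c ^ (1 - p) * x ^ (c * (p - 1)) * (t ^ c * (inner ℂ ξ ((f t ^ p) ξ)).re) :=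
    fun t ht => by
    rw [hwp t ht]
    ring
  have hJ := re_inner_rpow_le_integral (μ := volume.restrict (Ioc 0 x)) (w := w) hfx hF
    ((ae_restrict_mem measurableSet_Ioc).mono fun t ht => by
      have ht0 : 0 < t := ht.1
      simp only [w]
      positivity)
    (hwint.const_mul _) hw1 hp1 hp2 ξ
    ((integrableOn_congr_fun heq measurableSet_Ioc).2 (hφi.const_mul _))
  rw [setIntegral_congr_fun measurableSet_Ioc heq, integral_const_mul] at hJ
  have hx' : (1 / x) ^ p = x ^ (-p) := by
    rw [one_div, Real.inv_rpow hx.le, Real.rpow_neg hx.le]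
  rw [hardyAverage, rpow_smul_of_nonneg hF0 (by positivity) hp0.le, smul_apply,
    inner_smul_right_eq_smul, Complex.smul_re, smul_eq_mul, hx']
  refine (mul_le_mul_of_nonneg_left hJ (by positivity)).trans_eq ?_
  have e3 : -1 - c = -p + c * (p - 1) := by
    rw [hcdef]
    field_simp
    ring
  rw [e3, Real.rpow_add hx]
  ring

theorem weaklyMeasurable_hardyAverage_rpow (hp : 1 < p)
    (hf : ∀ x ∈ Ioi (0 : ℝ), 0 ≤ f x) (hm : WeaklyMeasurable f)
    (hT : HasWeakIntegral (fun x => f x ^ p) (Ioi 0) T) :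
    WeaklyMeasurable fun x => hardyAverage f x ^ p := fun _ _ =>
  (ContinuousOn.inner (𝕜 := ℂ) continuousOn_const
    ((continuousOn_hardyAverage_rpow hp hf hm hT).clm_apply continuousOn_const)).aestronglyMeasurable measurableSet_Ioi

/-- Hardy's inequality for the quadratic form at a single vector. -/
theorem setIntegral_re_inner_hardyAverage_rpow_le (hp1 : 1 < p) (hp2 : p ≤ 2)
    (hf : ∀ x ∈ Ioi (0 : ℝ), 0 ≤ f x) (hm : WeaklyMeasurable f)
    (hT : HasWeakIntegral (fun x => f x ^ p) (Ioi 0) T) (ξ : H) :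
    IntegrableOn (fun x => (inner ℂ ξ ((hardyAverage f x ^ p) ξ)).re) (Ioi 0) ∧
      ∫ x in Ioi 0, (inner ℂ ξ ((hardyAverage f x ^ p) ξ)).re ≤
        (p / (p - 1)) ^ p * (inner ℂ ξ (T ξ)).re := by
  have hp0 : 0 < p := by linarith
  have hc : 0 < 1 - 1 / p := by
    have : 1 / p < 1 := (div_lt_one hp0).2 hp1
    linarith
  have hconst : (1 - 1 / p) ^ (1 - p) * (1 - 1 / p)⁻¹ = (p / (p - 1)) ^ p := by
    rw [← Real.rpow_neg_one (1 - 1 / p), ← Real.rpow_add hc]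
    have e1 : p / (p - 1) = (1 - 1 / p)⁻¹ := by
      have : p - 1 ≠ 0 := by linarith
      field_simp
    rw [e1, Real.inv_rpow hc.le, ← Real.rpow_neg hc.le]
    ring_nf
  have hφ : IntegrableOn (fun t => (inner ℂ ξ ((f t ^ p) ξ)).re) (Ioi 0) := (hT ξ ξ).1.re
  have hφT : ∫ t in Ioi 0, (inner ℂ ξ ((f t ^ p) ξ)).re = (inner ℂ ξ (T ξ)).re :=
    integral_re_inner (hT ξ ξ)
  obtain ⟨h1, h2⟩ := integral_rpow_mul_integral_Ioc hφ hc
  have h1' := h1.const_mul ((1 - 1 / p) ^ (1 - p))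
  have hb : ∀ x ∈ Ioi (0 : ℝ), (inner ℂ ξ ((hardyAverage f x ^ p) ξ)).re ≤
      (1 - 1 / p) ^ (1 - p) * (x ^ (-1 - (1 - 1 / p)) *
        ∫ t in Ioc 0 x, t ^ (1 - 1 / p) * (inner ℂ ξ ((f t ^ p) ξ)).re) := fun x hx =>
    re_inner_hardyAverage_rpow_le hp1 hp2 hf hm hT hx ξ
  have hi : IntegrableOn (fun x => (inner ℂ ξ ((hardyAverage f x ^ p) ξ)).re) (Ioi 0) := by
    refine h1'.mono' (Complex.continuous_re.comp_aestronglyMeasurable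
      (weaklyMeasurable_hardyAverage_rpow hp1 hf hm hT ξ ξ)) ?_
    filter_upwards [ae_restrict_mem measurableSet_Ioi] with x hx
    rw [Real.norm_of_nonneg (re_inner_nonneg_of_nonneg CFC.rpow_nonneg ξ)]
    exact hb x hx
  refine ⟨hi, (setIntegral_mono_on hi h1' measurableSet_Ioi hb).trans_eq ?_⟩
  rw [integral_const_mul, h2, ← mul_assoc, hconst, hφT]

theorem exists_hasWeakIntegral_hardyAverage_rpow (hp1 : 1 < p) (hp2 : p ≤ 2)
    (hf : ∀ x ∈ Ioi (0 : ℝ), 0 ≤ f x) (hm : WeaklyMeasurable f)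
    (hT : HasWeakIntegral (fun x => f x ^ p) (Ioi 0) T) :
    ∃ S, HasWeakIntegral (fun x => hardyAverage f x ^ p) (Ioi 0) S ∧
      S ≤ (p / (p - 1)) ^ p • T := by
  have hquad := setIntegral_re_inner_hardyAverage_rpow_le hp1 hp2 hf hm hT
  have hpos : 0 ≤ (p / (p - 1)) ^ p :=
    Real.rpow_nonneg (div_nonneg (by linarith) (by linarith)) p
  obtain ⟨S, hS⟩ := exists_operator_of_quadratic (μ := volume.restrict (Ioi 0))
    (g := fun x => hardyAverage f x ^ p) (C := (p / (p - 1)) ^ p * ‖T‖)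
    (Filter.Eventually.of_forall fun x => CFC.rpow_nonneg)
    (weaklyMeasurable_hardyAverage_rpow hp1 hf hm hT) (fun ξ => (hquad ξ).1)
    (fun ξ => (hquad ξ).2.trans (by
      have h := re_inner_apply_le_norm T ξ ξ
      rw [← sq] at h
      rw [mul_assoc]
      gcongr))
  have hS' : HasWeakIntegral (fun x => hardyAverage f x ^ p) (Ioi 0) S := hS
  have hT0 : 0 ≤ T :=
    hT.nonneg measurableSet_Ioi fun x _ => CFC.rpow_nonneg
  have hS0 : 0 ≤ S :=
    hS'.nonneg measurableSet_Ioi fun x _ => CFC.rpow_nonneg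
  refine ⟨S, hS', (le_iff_re_inner_le hS0 (smul_nonneg hpos hT0)).2 fun ξ => ?_⟩
  have hSξ : ∫ x in Ioi 0, (inner ℂ ξ ((hardyAverage f x ^ p) ξ)).re = (inner ℂ ξ (S ξ)).re :=
    hS'.integral_re ξ ξ
  rw [smul_apply, inner_smul_right_eq_smul, Complex.smul_re, smul_eq_mul, ← hSξ]
  exact (hquad ξ).2

end Hardy

end

/-! ### Optimality of the constant -/

section

variable {H : Type*} [NormedAddCommGroup H] [InnerProductSpace ℂ H]

theorem inner_smul_one_apply (r : ℝ) (ξ η : H) :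
    inner ℂ ξ ((r • (1 : H →L[ℂ] H)) η) = r • inner ℂ ξ η := by
  rw [smul_apply, inner_smul_right_eq_smul, one_apply_eq_self]

theorem re_inner_smul_one_apply_self (r : ℝ) (ξ : H) :
    (inner ℂ ξ ((r • (1 : H →L[ℂ] H)) ξ)).re = r * ‖ξ‖ ^ 2 := by
  rw [inner_smul_one_apply, Complex.smul_re, smul_eq_mul, inner_self_eq_norm_sq_to_K]
  norm_cast

theorem hasWeakIntegral_smul_one {g : ℝ → ℝ} {s : Set ℝ} (hg : IntegrableOn g s) :
    HasWeakIntegral (fun x => g x • (1 : H →L[ℂ] H)) s ((∫ x in s, g x) • 1) := fun ξ η => by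
  simp only [inner_smul_one_apply]
  exact ⟨hg.smul_const _, integral_smul_const _ _⟩

theorem HasWeakIntegral.congr {f g : ℝ → H →L[ℂ] H} {s : Set ℝ} {T : H →L[ℂ] H}
    (hf : HasWeakIntegral f s T) (hs : MeasurableSet s) (h : ∀ x ∈ s, f x = g x) :
    HasWeakIntegral g s T := fun ξ η => by
  have h' : ∀ x ∈ s, (inner ℂ ξ (f x η) : ℂ) = inner ℂ ξ (g x η) := fun x hx => by rw [h x hx]
  exact ⟨(integrableOn_congr_fun h' hs).1 (hf ξ η).1,
    (setIntegral_congr_fun hs h').symm.trans (hf ξ η).2⟩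

theorem integrableOn_Ioc_rpow_neg {a x : ℝ} (ha : a < 1) (hx : 0 ≤ x) :
    IntegrableOn (fun t : ℝ => t ^ (-a)) (Ioc 0 x) :=
  (intervalIntegrable_iff_integrableOn_Ioc_of_le hx).1
    (intervalIntegral.intervalIntegrable_rpow' (by linarith))

theorem integral_Ioc_rpow_neg {a x : ℝ} (ha : a < 1) (hx : 0 ≤ x) :
    ∫ t in Ioc 0 x, t ^ (-a) = x ^ (1 - a) / (1 - a) := by
  rw [← intervalIntegral.integral_of_le hx, integral_rpow (Or.inl (by linarith)),
    Real.zero_rpow (by linarith), sub_zero]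
  congr 1 <;> ring_nf

theorem exists_lt_rpow_of_lt {p C : ℝ} (hp : 1 < p) (hC : C < (p / (p - 1)) ^ p) :
    ∃ a : ℝ, 0 < a ∧ a < 1 / p ∧ C < (1 - a)⁻¹ ^ p := by
  have hp0 : 0 < p := by linarith
  have hp' : p - 1 ≠ 0 := by linarith
  have h1 : p / (p - 1) = (1 - 1 / p)⁻¹ := by field_simp
  have hne : 1 - 1 / p ≠ 0 := by
    have : 1 / p < 1 := (div_lt_one hp0).2 hp
    linarith
  have hc : ContinuousAt (fun a : ℝ => (1 - a)⁻¹ ^ p) (1 / p) :=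
    ((continuousAt_const.sub continuousAt_id).inv₀ hne).rpow_const (Or.inr hp0.le)
  rw [h1] at hC
  have hev : ∀ᶠ a in nhdsWithin (1 / p) (Iio (1 / p)), C < (1 - a)⁻¹ ^ p :=
    (hc.eventually (lt_mem_nhds hC)).filter_mono nhdsWithin_le_nhds
  have hev2 : ∀ᶠ a in nhdsWithin (1 / p) (Iio (1 / p)), 0 < a :=
    (lt_mem_nhds (by positivity : 0 < 1 / p)).filter_mono nhdsWithin_le_nhds
  obtain ⟨a, ⟨h2, h3⟩, h4⟩ := ((hev.and hev2).and self_mem_nhdsWithin).exists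
  exact ⟨a, h3, h4, h2⟩

/-- The truncated powers `x ↦ x ^ (-a)` on `(0, 1]`, times the identity operator. Their Hardy
average on `(0, 1]` is `(1 - a)⁻¹` times the function itself, and the factor `(1 - a)⁻¹` tends to
`p / (p - 1)` as `a` increases to `1 / p`. -/
noncomputable def truncatedPower (H : Type*) [NormedAddCommGroup H] [InnerProductSpace ℂ H]
    (a x : ℝ) : H →L[ℂ] H :=
  (Iic 1).indicator (fun t : ℝ => t ^ (-a)) x • (1 : H →L[ℂ] H)

theorem weaklyMeasurable_truncatedPower (a : ℝ) : WeaklyMeasurable (truncatedPower H a) :=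
  fun ξ η => by
  simp only [truncatedPower, inner_smul_one_apply]
  have h : Measurable ((Iic 1).indicator fun t : ℝ => t ^ (-a)) :=
    Measurable.indicator (by fun_prop) measurableSet_Iic
  exact h.aestronglyMeasurable.smul_const _

theorem hardyAverage_truncatedPower {a : ℝ} (ha : a < 1) {x : ℝ} (hx0 : 0 < x) (hx1 : x ≤ 1) :
    hardyAverage (truncatedPower H a) x = (x ^ (-a) * (1 - a)⁻¹) • 1 := by
  have h := hasWeakIntegral_smul_one (H := H) (integrableOn_Ioc_rpow_neg ha hx0.le)
  rw [integral_Ioc_rpow_neg ha hx0.le] at h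
  have h' : HasWeakIntegral (truncatedPower H a) (Ioc 0 x) _ :=
    h.congr measurableSet_Ioc fun t ht => by
      rw [truncatedPower, indicator_of_mem (show t ∈ Iic (1 : ℝ) from ht.2.trans hx1)]
  rw [hardyAverage, h'.weakIntegral_eq, smul_smul]
  congr 1
  rw [show 1 - a = -a + 1 by ring, Real.rpow_add_one hx0.ne']
  field_simp

variable [CompleteSpace H]

theorem truncatedPower_nonneg (a : ℝ) {x : ℝ} (hx : 0 < x) : 0 ≤ truncatedPower H a x :=
  smul_nonneg (indicator_apply_nonneg fun _ => by positivity) zero_le_one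

theorem rpow_smul_one {r p : ℝ} (hr : 0 ≤ r) (hp : 0 ≤ p) :
    (r • (1 : H →L[ℂ] H)) ^ p = r ^ p • (1 : H →L[ℂ] H) := by
  rw [rpow_smul_of_nonneg zero_le_one hr hp, CFC.one_rpow]

theorem hasWeakIntegral_truncatedPower_rpow {a p : ℝ} (hp : 0 < p) (hap : a * p < 1) :
    HasWeakIntegral (fun x => truncatedPower H a x ^ p) (Ioi 0) ((1 - a * p)⁻¹ • 1) := by
  have hi : IntegrableOn ((Iic 1).indicator fun t : ℝ => t ^ (-(a * p))) (Ioi 0) := by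
    rw [integrableOn_indicator_iff measurableSet_Iic, inter_comm, Ioi_inter_Iic]
    exact integrableOn_Ioc_rpow_neg hap zero_le_one
  have h := hasWeakIntegral_smul_one (H := H) hi
  rw [setIntegral_indicator measurableSet_Iic, Ioi_inter_Iic,
    integral_Ioc_rpow_neg hap zero_le_one, Real.one_rpow, one_div] at h
  refine h.congr measurableSet_Ioi fun x (hx : 0 < x) => ?_
  rw [truncatedPower, rpow_smul_one (indicator_apply_nonneg fun _ => by positivity) hp.le]
  congr 1
  by_cases hx1 : x ∈ Iic (1 : ℝ)
  · rw [indicator_of_mem hx1, indicator_of_mem hx1, ← Real.rpow_mul hx.le, neg_mul]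
  · rw [indicator_of_notMem hx1, indicator_of_notMem hx1, Real.zero_rpow hp.ne']

/-- Restricting the left-hand side of Hardy's inequality to `(0, 1]` already gives the factor
`(1 - a)⁻¹ ^ p`. -/
theorem not_le_smul_of_truncatedPower [Nontrivial H] {a p C : ℝ} (hp : 0 < p) (ha1 : a < 1)
    (hap : a * p < 1) (hC : C < (1 - a)⁻¹ ^ p) {S : H →L[ℂ] H}
    (hS : HasWeakIntegral (fun x => hardyAverage (truncatedPower H a) x ^ p) (Ioi 0) S) :
    ¬ S ≤ C • ((1 - a * p)⁻¹ • (1 : H →L[ℂ] H)) := by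
  intro hle
  obtain ⟨ξ, hξ⟩ := exists_ne (0 : H)
  have hξ' : 0 < ‖ξ‖ ^ 2 := by positivity
  have h1 : (inner ℂ ξ (S ξ)).re ≤ C * (1 - a * p)⁻¹ * ‖ξ‖ ^ 2 := by
    have h := re_inner_nonneg_of_nonneg (sub_nonneg.2 hle) ξ
    rw [smul_smul, sub_apply, inner_sub_right, Complex.sub_re, re_inner_smul_one_apply_self] at h
    linarith
  have h2 : ∫ x in Ioc 0 1, (inner ℂ ξ ((hardyAverage (truncatedPower H a) x ^ p) ξ)).re ≤
      (inner ℂ ξ (S ξ)).re := by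
    rw [← hS.integral_re ξ ξ]
    exact setIntegral_mono_set (hS ξ ξ).1.re
      (Filter.Eventually.of_forall fun x => re_inner_nonneg_of_nonneg CFC.rpow_nonneg ξ)
      Ioc_subset_Ioi_self.eventuallyLE
  have h3 : ∫ x in Ioc 0 1, (inner ℂ ξ ((hardyAverage (truncatedPower H a) x ^ p) ξ)).re =
      (1 - a)⁻¹ ^ p * (1 - a * p)⁻¹ * ‖ξ‖ ^ 2 := by
    have h : ∀ x ∈ Ioc (0 : ℝ) 1,
        (inner ℂ ξ ((hardyAverage (truncatedPower H a) x ^ p) ξ)).re =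
          x ^ (-(a * p)) * ((1 - a)⁻¹ ^ p * ‖ξ‖ ^ 2) := fun x hx => by
      have hx0 : 0 < x := hx.1
      have ha' : 0 ≤ (1 - a)⁻¹ := inv_nonneg.2 (by linarith)
      rw [hardyAverage_truncatedPower ha1 hx.1 hx.2, rpow_smul_one (by positivity) hp.le,
        re_inner_smul_one_apply_self, Real.mul_rpow (by positivity) ha', ← Real.rpow_mul hx0.le,
        neg_mul, mul_assoc]
    rw [setIntegral_congr_fun measurableSet_Ioc h, integral_mul_const,
      integral_Ioc_rpow_neg hap zero_le_one, Real.one_rpow]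
    ring
  have h4 : 0 < (1 - a * p)⁻¹ := inv_pos.2 (by linarith)
  have h5 : C * (1 - a * p)⁻¹ * ‖ξ‖ ^ 2 < (1 - a)⁻¹ ^ p * (1 - a * p)⁻¹ * ‖ξ‖ ^ 2 := by gcongr
  linarith

end

theorem mainTheorem1 {H : Type*} [NormedAddCommGroup H] [InnerProductSpace ℂ H]
    [CompleteSpace H] (p : ℝ) (hp1 : 1 < p) (hp2 : p ≤ 2) :
    (∀ f : ℝ → H →L[ℂ] H, (∀ x ∈ Ioi (0 : ℝ), 0 ≤ f x) → WeaklyMeasurable f →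
      WeaklyIntegrableOn (fun x => f x ^ p) (Ioi 0) →
        (∀ x ∈ Ioi (0 : ℝ), WeaklyIntegrableOn f (Ioc 0 x)) ∧
        WeaklyIntegrableOn (fun x => hardyAverage f x ^ p) (Ioi 0) ∧
        weakIntegral (fun x => hardyAverage f x ^ p) (Ioi 0) ≤
          (p / (p - 1)) ^ p • weakIntegral (fun x => f x ^ p) (Ioi 0)) ∧
    (Nontrivial H → ∀ C : ℝ, C < (p / (p - 1)) ^ p →
      ∃ f : ℝ → H →L[ℂ] H, (∀ x ∈ Ioi (0 : ℝ), 0 ≤ f x) ∧ WeaklyMeasurable f ∧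
        WeaklyIntegrableOn (fun x => f x ^ p) (Ioi 0) ∧
        ¬ weakIntegral (fun x => hardyAverage f x ^ p) (Ioi 0) ≤
          C • weakIntegral (fun x => f x ^ p) (Ioi 0)) := by
  refine ⟨fun f hf hm ⟨T, hT⟩ => ?_, fun hH C hC => ?_⟩
  · obtain ⟨S, hS, hle⟩ := exists_hasWeakIntegral_hardyAverage_rpow hp1 hp2 hf hm hT
    refine ⟨fun x _ => ⟨_, hasWeakIntegral_weakIntegral_Ioc hp1.le hf hm hT x⟩, ⟨S, hS⟩, ?_⟩
    rwa [hS.weakIntegral_eq, hT.weakIntegral_eq]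
  · obtain ⟨a, ha0, hap, haC⟩ := exists_lt_rpow_of_lt hp1 hC
    have hp0 : 0 < p := by linarith
    have hap' : a * p < 1 := (lt_div_iff₀ hp0).1 hap
    have ha1 : a < 1 := hap.trans ((div_lt_one hp0).2 hp1)
    have hf : ∀ x ∈ Ioi (0 : ℝ), 0 ≤ truncatedPower H a x := fun x hx =>
      truncatedPower_nonneg a hx
    have hm := weaklyMeasurable_truncatedPower (H := H) a
    have hT := hasWeakIntegral_truncatedPower_rpow (H := H) hp0 hap'
    obtain ⟨S, hS, -⟩ := exists_hasWeakIntegral_hardyAverage_rpow hp1 hp2 hf hm hT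
    refine ⟨truncatedPower H a, hf, hm, ⟨_, hT⟩, ?_⟩
    rw [hS.weakIntegral_eq, hT.weakIntegral_eq]
    exact not_le_smul_of_truncatedPower hp0 ha1 hap' haC hS
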